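/- \textbf{Model.} A node is a finite sequence of natural numbers (port numbers); the root is the empty sequence, the parent of a nonempty sequence is obtained by deleting its last entry, the depth of a node is its length, and its ancestors are its prefixes (including itself). The distance of $u,v$ is $d(u,v)=|u|+|v|-2|u\wedge v|$, with $u\wedge v$ the longest common prefix. A tree $T$ is a finite set of nodes that contains the root and is closed under taking parents; $n$ is its number of nodes and $D$ the maximum depth of its nodes. In \emph{distributed asynchronous collective tree exploration} (DACTE), $k\ge 1$ robots with indices $1,\dots,k$ start at the root of an unknown tree $T$. Each node has a whiteboard and each robot has an internal memory, both of unbounded size and initially empty. In each round an omniscient adversary activates one robot, which then (i) reads the whiteboard at its position, (ii) observes the adjacent nodes, (iii) writes on that whiteboard and updates its memory, (iv) moves to an adjacent node of its choice (if there is one). A DACTE algorithm specifies (iii) and (iv) as a function of the index of the robot, its memory, the whiteboard at its position and the set of adjacent nodes only; it may depend on $k$, but not on $T$. A node is visited when a robot located at it is activated. The algorithm explores $T$ in at most $M$ moves if, for every sequence of activations, all nodes of $T$ have been visited after at most $M$ rounds. A \emph{layered tree} is a sequence $\mathcal L(1),\mathcal L(2),\dots$ of finite nonempty sets of nodes (layers),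 each consisting of pairwise incomparable nodes for the ancestor order, such that each node of $\mathcal L(t+1)$ has an ancestor in $\mathcal L(t)$. Its depth is the maximum depth of a node of its layers (inputs of infinite depth are not considered in the competitive ratio). A deterministic traversal algorithm of width $w$ is a function $\ell$ that maps each partial input $(\mathcal L(1),\dots,\mathcal L(t))$, with layers of at most $w$ nodes, to a node $\ell(t)\in\mathcal L(t)$; with $\ell(0)$ the root, it is $c$-competitive if $\sum_{t\ge1}d(\ell(t-1),\ell(t))\le c\,D$ for each layered tree of finite depth $D$ whose layers have at most $w$ nodes. \textbf{Theorem.} \begin{enumerate} \item There is a constant $C$ such that for every $k\ge1$ there is a DACTE algorithm for $k$ robots that explores every tree with $n$ nodes and depth $D$ in at most $2n+C\,k^2 2^k D$ moves. \item For every $k\ge1$ and every real $c$: if there is a $c$-competitive deterministic traversal algorithm of width $k$, then there is a DACTE algorithm for $k$ robots that explores every tree with $n$ nodes and depth $D$ in at most $2n+k\,c\,D$ moves. \item There is a constant $C$ such that for every $k\ge2$ there is a DACTE algorithm for $k$ robots that explores every tree with $n$ nodes and depth $D$ in at most $C\,\frac{k}{\log_2 k}\,(n+kD)$ moves. \end{enumerate}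 -/

import Mathlib

/-! ### Nodes and trees -/

/-- A node is the list of port numbers leading to it from the root; the root is `[]`. The parent of
`u ≠ []` is `u.dropLast`, the depth of `u` is `u.length`, and the ancestors of `u` (including `u`)
are its prefixes. -/
abbrev Node : Type := List ℕ

namespace Node

/-- `v` is a child of `u`, i.e. `v` is not the root and its parent is `u`. -/
abbrev IsChild (v u : Node) : Prop := v ≠ [] ∧ v.dropLast = u

/-- Lowest common ancestor (longest common prefix). -/
def lca : Node → Node → Node
  | a :: u, b :: v => if a = b then a :: lca u v else []
  | _, _ => []

/-- Distance `d(u) + d(v) - 2 d(lca u v)`; the subtraction never truncates, as the lowest common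
ancestor is no deeper than either node. -/
def dist (u v : Node) : ℕ := u.length + v.length - 2 * (lca u v).length

end Node

/-- A finite rooted (ordered) tree: a finite set of nodes that contains the root and is closed
under taking parents. -/
structure FinTree where
  nodes : Finset Node
  root_mem : [] ∈ nodes
  parent_mem : ∀ u ∈ nodes, u ≠ [] → u.dropLast ∈ nodes

namespace FinTree

/-- Number `n` of nodes. -/
def size (T : FinTree) : ℕ := T.nodes.card

/-- Depth `D`: the largest depth of a node. -/
def depth (T : FinTree) : ℕ := T.nodes.sup List.length

/-- Nodes of `T` adjacent to `u`: its children in `T`, and its parent if `u` is not the root. -/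
def neighbors (T : FinTree) (u : Node) : Finset Node :=
  T.nodes.filter fun v => Node.IsChild v u ∨ Node.IsChild u v

end FinTree

/-! ### Distributed asynchronous collective tree exploration -/

/-- A (deterministic) distributed asynchronous collective tree exploration algorithm for `k` robots,
indexed by `Fin k`. Internal memories and whiteboards hold elements of arbitrary types (unbounded
storage). When robot `i` is activated, all that it has access to is its index, its internal memory,
the whiteboard of the node where it stands, and the set of nodes adjacent to that node. From these
it computes the new content of this whiteboard, its new internal memory, and the neighbor it moves
to. -/
structure DACTEAlgorithm (k : ℕ) where
  Mem : Type
  Board : Type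
  /-- Initial (empty) internal memory, the same for all robots. -/
  emptyMem : Mem
  /-- Initial (empty) whiteboard, the same at all nodes. -/
  emptyBoard : Board
  write : Fin k → Mem → Board → Finset Node → Board
  remember : Fin k → Mem → Board → Finset Node → Mem
  move : Fin k → Mem → Board → Finset Node → Node
  /-- The robot always moves to a node adjacent to its position, if there is one. -/
  move_mem : ∀ i m b (N : Finset Node), N.Nonempty → move i m b N ∈ N

namespace DACTEAlgorithm

variable {k : ℕ}

/-- State of the team: position and memory of each robot, whiteboard of each node. -/
structure Config (A : DACTEAlgorithm k) where
  pos : Fin k → Node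
  mem : Fin k → A.Mem
  board : Node → A.Board

/-- All robots are at the root; all registers are empty. -/
def initial (A : DACTEAlgorithm k) : Config A where
  pos := fun _ => []
  mem := fun _ => A.emptyMem
  board := fun _ => A.emptyBoard

/-- One round in the tree `T`, in which the adversary activates robot `i`: it reads the whiteboard
at its position, observes the adjacent nodes, writes on the whiteboard at its position and updates
its memory, and then moves (it stays put only in the one-node tree, where it has no neighbor). -/
def step (A : DACTEAlgorithm k) (T : FinTree) (c : Config A) (i : Fin k) : Config A where
  pos := Function.update c.pos i
    (if (T.neighbors (c.pos i)).Nonempty then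
      A.move i (c.mem i) (c.board (c.pos i)) (T.neighbors (c.pos i))
    else c.pos i)
  mem := Function.update c.mem i
    (A.remember i (c.mem i) (c.board (c.pos i)) (T.neighbors (c.pos i)))
  board := Function.update c.board (c.pos i)
    (A.write i (c.mem i) (c.board (c.pos i)) (T.neighbors (c.pos i)))

/-- The configuration after `t` rounds in the tree `T`, when the adversary activates robot `s r` in
round `r`. -/
def run (A : DACTEAlgorithm k) (T : FinTree) (s : ℕ → Fin k) : ℕ → Config A
  | 0 => A.initial
  | t + 1 => A.step T (A.run T s t) (s t)

/-- Node `u` is visited during the first `t` rounds: a robot standing at `u` is activated in one of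
them. -/
def Visited (A : DACTEAlgorithm k) (T : FinTree) (s : ℕ → Fin k) (t : ℕ) (u : Node) : Prop :=
  ∃ r < t, (A.run T s r).pos (s r) = u

/-- Whatever the adversary does, all nodes of `T` are visited within at most `M` moves (one robot
moves in each round). As the algorithm is deterministic, an omniscient adaptive adversary amounts to
an arbitrary sequence of activations. -/
def ExploresWithin (A : DACTEAlgorithm k) (T : FinTree) (M : ℝ) : Prop :=
  ∀ s : ℕ → Fin k, ∃ t : ℕ, (t : ℝ) ≤ M ∧ ∀ u ∈ T.nodes, A.Visited T s t u

end DACTEAlgorithm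

/-! ### Deterministic layered tree traversal -/

/-- A layered tree: a sequence of (nonempty, finite) layers, i.e. sets of nodes that are pairwise
incomparable for the ancestor order, such that each node of a layer has an ancestor in the preceding
layer. -/
structure LayeredTree where
  layer : ℕ → Finset Node
  nonempty : ∀ t, (layer t).Nonempty
  antichain : ∀ t, ∀ u ∈ layer t, ∀ v ∈ layer t, u <+: v → u = v
  descends : ∀ t, ∀ v ∈ layer (t + 1), ∃ u ∈ layer t, u <+: v

namespace LayeredTree

/-- All layers have at most `w` nodes. -/
def WidthLE (L : LayeredTree) (w : ℕ) : Prop := ∀ t, (L.layer t).card ≤ w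

/-- The underlying tree: all ancestors of nodes of the layers. -/
def underlying (L : LayeredTree) : Set Node := {u | ∃ t, ∃ v ∈ L.layer t, u <+: v}

/-- The underlying tree has (finite) depth `D`. -/
def HasDepth (L : LayeredTree) (D : ℕ) : Prop := IsGreatest (List.length '' L.underlying) D

/-- The partial input: the list of the layers with indices `0, …, t`. -/
def upTo (L : LayeredTree) (t : ℕ) : List (Finset Node) := (List.range (t + 1)).map L.layer

end LayeredTree

/-- `ℓ`, a function of the layers revealed so far, is a deterministic tree traversal algorithm for
inputs of width at most `w`: it always selects a node of the current layer. -/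
def IsTraversal (w : ℕ) (ℓ : List (Finset Node) → Node) : Prop :=
  ∀ L : LayeredTree, L.WidthLE w → ∀ t, ℓ (L.upTo t) ∈ L.layer t

/-- Cost of `ℓ` on the first `t` layers of `L`: the total distance traveled, starting at the
root. -/
def traversalCost (ℓ : List (Finset Node) → Node) (L : LayeredTree) (t : ℕ) : ℕ :=
  ∑ s ∈ Finset.range t, Node.dist (if s = 0 then [] else ℓ (L.upTo (s - 1))) (ℓ (L.upTo s))

/-- `ℓ` is a `c`-competitive deterministic traversal algorithm for layered trees of width at most
`w`: on each such input of depth `D`, its total cost is at most `c * D`. -/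
def IsCompetitive (w : ℕ) (c : ℝ) (ℓ : List (Finset Node) → Node) : Prop :=
  IsTraversal w ℓ ∧
    ∀ (L : LayeredTree) (D : ℕ), L.WidthLE w → L.HasDepth D →
      ∀ t, (traversalCost ℓ L t : ℝ) ≤ c * D

/-!
The theorem rests on three constructions.

**Exploration guided by a traversal algorithm** (`Exploration.explorer_exploresWithin`). Robots keep
all that they know and copy it to the whiteboards. A robot goes down to a child that nobody has
opened if there is one, and returns when there is none: these *excursions* traverse each edge once
in either direction, which gives the term `2 * n`. A robot that is back at the start of its
excursion has to find other work. All work left is below the minimal opened nodes that are not known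
to be done, so it passes these nodes as a new layer to the traversal algorithm and makes a step
towards the node that is selected. Knowledge only grows, so the layers form a layered tree inside
`T`, and these steps are paid for by the moves of the traversal algorithm. Its width is at most `k`,
because each node of a layer belongs to the current excursion, as far as known, of the robot that
opened it: when a robot opens a node, it has marked as done every node that it opened before and
that is not an ancestor of the new one, and whoever learns about the new node learns about these
marks, too (`Exploration.Separated`).

**A traversal algorithm with ratio `O(w * 2 ^ w)`** (`Traversal.algorithm_isCompetitive`). Writing
ports in unary makes layers into binary trees. With `δ = 1 / w` and `θ = 2 + δ`, a branching whose
sides, the edges to them included, have values `a` and `b` gets the value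
`min ((a + b) / θ) (min a b)`. This value does not decrease as the tree evolves, and it is at most
the depth of any node of the layer. The server leaves its side of a branching when the value `a` of
this side exceeds `(1 + δ) * b`, and then descends to the sides of smaller value. Since
`(1 + δ) * b + b = θ * b`, nothing is lost at this moment. A penalty proportional to the excess of
the server's side at each branching, subtracted from the value, makes a potential that grows enough
to pay for such a move, and for the move after the death of the server's side
(`BinTree.pot_add_le_of_switch`). An edge below `l` branchings counts with weight about `θ ^ (-l)`,
and the penalty may be the stronger the fewer tips are left. So the strength of the penalty is of
order `θ ^ (-m)` at a branching with `m` tips, which costs only a constant factor, and the gain in a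
switch is smaller than the distance by a factor of order `w * θ ^ w`, which is `O(w * 2 ^ w)`.

**Independent groups** (`Exploration.exists_grouped`). If the robots are divided into groups of
about `log k / 2` robots which ignore each other, then the overhead of a group is `O(k * D)`, and
some group has explored the tree as soon as the total number of moves exceeds the sum of the bounds
of the `O(k / log k)` groups.
-/

/-! ### The metric on nodes -/

namespace Node

theorem lca_prefix_left (u v : Node) : lca u v <+: u := by
  induction u generalizing v with
  | nil => simp [lca]
  | cons a u ih =>
    cases v with
    | nil => simp [lca]
    | cons b v =>
      by_cases h : a = b
      · simpa [lca, h] using ih v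
      · simp [lca, h]

theorem lca_comm (u v : Node) : lca u v = lca v u := by
  induction u generalizing v with
  | nil => cases v <;> simp [lca]
  | cons a u ih =>
    cases v with
    | nil => simp [lca]
    | cons b v =>
      by_cases h : a = b
      · simp [lca, h, ih v]
      · simp [lca, h, Ne.symm h]

theorem lca_prefix_right (u v : Node) : lca u v <+: v :=
  lca_comm u v ▸ lca_prefix_left v u

theorem prefix_lca {p u v : Node} (hu : p <+: u) (hv : p <+: v) : p <+: lca u v := by
  induction p generalizing u v with
  | nil => simp
  | cons a p ih =>
    obtain ⟨u', rfl⟩ := hu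
    obtain ⟨v', rfl⟩ := hv
    simpa [lca] using ih (List.prefix_append p u') (List.prefix_append p v')

theorem lca_length_le_left (u v : Node) : (lca u v).length ≤ u.length :=
  (lca_prefix_left u v).length_le

theorem lca_length_le_right (u v : Node) : (lca u v).length ≤ v.length :=
  (lca_prefix_right u v).length_le

theorem dist_self (u : Node) : dist u u = 0 := by
  have h := (prefix_lca (List.prefix_refl u) (List.prefix_refl u)).length_le
  unfold dist
  omega

theorem dist_triangle (u v w : Node) : dist u w ≤ dist u v + dist v w := by
  have h1 := lca_length_le_left u v
  have h2 := lca_length_le_right u v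
  have h3 := lca_length_le_left v w
  have h4 := lca_length_le_right v w
  have key : min (lca u v).length (lca v w).length ≤ (lca u w).length := by
    rcases le_total (lca u v).length (lca v w).length with h | h
    · rw [min_eq_left h]
      have := List.prefix_of_prefix_length_le (lca_prefix_right u v) (lca_prefix_left v w) h
      exact (prefix_lca (lca_prefix_left u v) (this.trans (lca_prefix_right v w))).length_le
    · rw [min_eq_right h]
      have := List.prefix_of_prefix_length_le (lca_prefix_left v w) (lca_prefix_right u v) h
      exact (prefix_lca (this.trans (lca_prefix_left u v)) (lca_prefix_right v w)).length_le
  unfold dist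
  omega

/-- The neighbor of `p` on the way to `q`, when `p ≠ q`. -/
def stepToward (p q : Node) : Node :=
  if p <+: q then q.take (p.length + 1) else p.dropLast

theorem stepToward_of_prefix {p q : Node} (h : p <+: q) (hne : p ≠ q) :
    IsChild (stepToward p q) p ∧ stepToward p q <+: q := by
  obtain ⟨r, rfl⟩ := h
  cases r with
  | nil => simp at hne
  | cons a r =>
    have e : stepToward p (p ++ a :: r) = p ++ [a] := by
      simp [stepToward, List.take_append]
    rw [e]
    exact ⟨⟨by simp, by simp⟩, by simp⟩

theorem ne_nil_of_not_prefix {p q : Node} (h : ¬ p <+: q) : p ≠ [] := by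
  rintro rfl
  exact h List.nil_prefix

theorem dist_stepToward {p q : Node} (hne : p ≠ q) :
    dist (stepToward p q) q + 1 = dist p q := by
  have h0 := lca_length_le_left p q
  have h1 := lca_length_le_right p q
  by_cases h : p <+: q
  · obtain ⟨⟨hnil, hd⟩, hpre⟩ := stepToward_of_prefix h hne
    have e1 := (prefix_lca (List.prefix_refl p) h).length_le
    have e2 := (prefix_lca (List.prefix_refl _) hpre).length_le
    have h2 := lca_length_le_left (stepToward p q) q
    have h3 := lca_length_le_right (stepToward p q) q
    have e3 : (stepToward p q).length = p.length + 1 := by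
      have := congrArg List.length hd
      have := List.length_pos_of_ne_nil hnil
      simp at *
      omega
    unfold dist
    omega
  · have hs : stepToward p q = p.dropLast := by simp [stepToward, h]
    have hlen : (p.dropLast).length + 1 = p.length := by
      have := List.length_pos_of_ne_nil (ne_nil_of_not_prefix h)
      simp
      omega
    have hlt : (lca p q).length < p.length := by
      refine lt_of_le_of_ne h0 fun e => h ?_
      have := (lca_prefix_left p q).eq_of_length e
      rw [← this]
      exact lca_prefix_right p q
    have hpre : lca p q <+: p.dropLast :=
      List.prefix_of_prefix_length_le (lca_prefix_left p q) (List.dropLast_prefix p) (by omega)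
    have e1 := (prefix_lca hpre (lca_prefix_right p q)).length_le
    have e2 := (prefix_lca ((lca_prefix_left p.dropLast q).trans (List.dropLast_prefix p))
      (lca_prefix_right p.dropLast q)).length_le
    have h2 := lca_length_le_left p.dropLast q
    have h3 := lca_length_le_right p.dropLast q
    rw [hs]
    unfold dist
    omega

end Node

/-! ### Binary trees and their value -/

/-- Shape of a finite set of binary words: `tip` stands for the empty word and `empty` for no word
at all. The edge to the child `false` has length 1, the edge to the child `true` has length 0. -/
inductive BinTree
  | empty
  | tip
  | node (c : Bool → BinTree)

namespace BinTree

/-- Length of the edge labelled `b`. -/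
def len (b : Bool) : ℝ := if b then 0 else 1

theorem len_nonneg (b : Bool) : 0 ≤ len b := by
  cases b <;> simp [len]

/-- Length of a path. -/
def pathLen : List Bool → ℝ
  | [] => 0
  | b :: p => len b + pathLen p

theorem pathLen_nonneg (p : List Bool) : 0 ≤ pathLen p := by
  induction p with
  | nil => simp [pathLen]
  | cons b p ih => exact add_nonneg (len_nonneg b) ih

/-- Tree distance of the endpoints of two paths from the root. -/
def pathDist : List Bool → List Bool → ℝ
  | b :: p, b' :: p' => if b = b' then pathDist p p' else pathLen (b :: p) + pathLen (b' :: p')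
  | [], p' => pathLen p'
  | b :: p, [] => pathLen (b :: p)

theorem pathDist_nonneg (p p' : List Bool) : 0 ≤ pathDist p p' := by
  induction p generalizing p' with
  | nil => cases p' <;> exact pathLen_nonneg _
  | cons b p ih =>
    cases p' with
    | nil => exact pathLen_nonneg _
    | cons b' p' =>
      rw [pathDist]
      split_ifs
      · exact ih _
      · exact add_nonneg (pathLen_nonneg _) (pathLen_nonneg _)

/-- The tree has a tip. -/
def Alive : BinTree → Prop
  | empty => False
  | tip => True
  | node c => ∃ b, (c b).Alive

/-- Number of tips. -/
def tips : BinTree → ℕ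
  | empty => 0
  | tip => 1
  | node c => (c false).tips + (c true).tips

/-- The path `p` leads from the root to a tip. -/
def IsTip : BinTree → List Bool → Prop
  | tip, [] => True
  | node c, b :: p => (c b).IsTip p
  | _, _ => False

theorem IsTip.alive {T : BinTree} {p : List Bool} (h : T.IsTip p) : T.Alive := by
  induction T generalizing p with
  | empty => simp [IsTip] at h
  | tip => trivial
  | node c ih =>
    cases p with
    | nil => simp [IsTip] at h
    | cons b p => exact ⟨b, ih b h⟩

theorem Alive.tips_pos {T : BinTree} (h : T.Alive) : 1 ≤ T.tips := by
  induction T with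
  | empty => exact h.elim
  | tip => exact le_rfl
  | node c ih =>
    obtain ⟨b, hb⟩ := h
    have := ih b hb
    cases b <;> simp only [tips] <;> omega

theorem tips_add (c : Bool → BinTree) (b : Bool) : (c b).tips + (c !b).tips = (node c).tips := by
  cases b
  · rfl
  · exact Nat.add_comm _ _

theorem alive_node (c : Bool → BinTree) (b : Bool) :
    (node c).Alive ↔ (c b).Alive ∨ (c !b).Alive := by
  constructor
  · rintro ⟨b', h⟩
    cases b <;> cases b' <;> simp_all
  · rintro (h | h)
    exacts [⟨_, h⟩, ⟨_, h⟩]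

/-- Growth of trees: tips may turn into arbitrary trees, subtrees may lose all their tips, and
nothing appears elsewhere. -/
inductive Evolve : BinTree → BinTree → Prop
  | grow (T' : BinTree) : Evolve tip T'
  | dead (T T' : BinTree) (h : ¬ T'.Alive) : Evolve T T'
  | node (c c' : Bool → BinTree) (h : ∀ b, Evolve (c b) (c' b)) : Evolve (node c) (node c')

theorem Evolve.alive {T T' : BinTree} (h : Evolve T T') (ha : T'.Alive) : T.Alive := by
  induction h with
  | grow T' => trivial
  | dead T T' h => exact absurd ha h
  | node c c' _ ih =>
    obtain ⟨b, hb⟩ := ha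
    exact ⟨b, ih b hb⟩

/-- Value of a branching whose sides have values `a` and `b`. The terms `a` and `b` keep it from
decreasing when one side dies. -/
noncomputable def merge (θ a b : ℝ) : ℝ := min ((a + b) / θ) (min a b)

theorem merge_comm (θ a b : ℝ) : merge θ a b = merge θ b a := by
  simp only [merge, add_comm, min_comm]

theorem merge_mono {θ a b a' b' : ℝ} (hθ : 0 < θ) (ha : a ≤ a') (hb : b ≤ b') :
    merge θ a b ≤ merge θ a' b' := by
  unfold merge
  gcongr

open Classical in
/-- The value of a tree: a discounted length of its edges, where each branching discounts by the
factor `θ` unless one of its sides alone is cheaper. It never decreases as the tree evolves and is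
at most the depth of each tip (`val_le_pathLen`). -/
noncomputable def val (θ : ℝ) : BinTree → ℝ
  | empty => 0
  | tip => 0
  | node c =>
    if (c false).Alive then
      if (c true).Alive then merge θ (len false + (c false).val θ) (len true + (c true).val θ)
      else len false + (c false).val θ
    else len true + (c true).val θ

theorem val_node_both (θ : ℝ) {c : Bool → BinTree} (b : Bool) (h : (c b).Alive)
    (h' : (c !b).Alive) :
    (node c).val θ = merge θ (len b + (c b).val θ) (len (!b) + (c !b).val θ) := by
  cases b
  · simp_all [val]
  · simp only [Bool.not_true] at h'
    simp [val, h, h', merge_comm]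

theorem val_node_single (θ : ℝ) {c : Bool → BinTree} (b : Bool) (h : (c b).Alive)
    (h' : ¬ (c !b).Alive) : (node c).val θ = len b + (c b).val θ := by
  cases b <;> simp_all [val]

theorem val_nonneg {θ : ℝ} (hθ : 0 < θ) (T : BinTree) : 0 ≤ T.val θ := by
  classical
  induction T with
  | empty => exact le_rfl
  | tip => exact le_rfl
  | node c ih =>
    have h0 := add_nonneg (len_nonneg false) (ih false)
    have h1 := add_nonneg (len_nonneg true) (ih true)
    unfold val
    split_ifs
    · exact le_min (div_nonneg (add_nonneg h0 h1) hθ.le) (le_min h0 h1)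
    · exact h0
    · exact h1

theorem val_node_le (θ : ℝ) {c : Bool → BinTree} (b : Bool) (h : (c b).Alive) :
    (node c).val θ ≤ len b + (c b).val θ := by
  by_cases h' : (c !b).Alive
  · rw [val_node_both θ b h h']
    exact (min_le_right _ _).trans (min_le_left _ _)
  · rw [val_node_single θ b h h']

theorem val_le_pathLen (θ : ℝ) {T : BinTree} {p : List Bool} (h : T.IsTip p) :
    T.val θ ≤ pathLen p := by
  induction T generalizing p with
  | empty => simp [IsTip] at h
  | tip => exact pathLen_nonneg p
  | node c ih =>
    cases p with
    | nil => simp [IsTip] at h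
    | cons b p =>
      have := ih b h
      exact (val_node_le θ b (IsTip.alive (p := p) h)).trans (by simpa [pathLen] using this)

theorem Evolve.val_mono {θ : ℝ} (hθ : 0 < θ) {T T' : BinTree} (h : Evolve T T') (ha : T'.Alive) :
    T.val θ ≤ T'.val θ := by
  induction h with
  | grow T' => exact val_nonneg hθ T'
  | dead T T' h => exact absurd ha h
  | node c c' h ih =>
    have key (b : Bool) (hb : (c' b).Alive) : len b + (c b).val θ ≤ len b + (c' b).val θ := by
      gcongr
      exact ih b hb
    obtain ⟨b, hb⟩ := ha
    have hb0 := (h b).alive hb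
    by_cases hb' : (c' !b).Alive
    · rw [val_node_both θ b hb hb', val_node_both θ b hb0 ((h _).alive hb')]
      exact merge_mono hθ (key b hb) (key _ hb')
    · rw [val_node_single θ b hb hb']
      exact (val_node_le θ b hb0).trans (key b hb)

/-! ### Stable tips and the potential -/

/-- The tip `p` is stable: at each branching above it, the value of its side exceeds that of the
other side at most by the factor `1 + δ`. -/
def Stable (θ δ : ℝ) : BinTree → List Bool → Prop
  | node c, b :: p => (c b).Stable θ δ p ∧
      ((c !b).Alive → len b + (c b).val θ ≤ (1 + δ) * (len (!b) + (c !b).val θ))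
  | _, _ => True

/-- Contribution of a branching to the potential: the sum of the potential `q` of the server's side
and of the value `b` of the other side, less a penalty of `ε` times the excess of `q` over `b`. -/
noncomputable def skew (ε q b : ℝ) : ℝ := min (q + b) ((1 - ε) * q + (1 + ε) * b)

theorem skew_mono {ε q b q' b' : ℝ} (h0 : 0 ≤ ε) (h1 : ε ≤ 1) (hq : q ≤ q') (hb : b ≤ b') :
    skew ε q b ≤ skew ε q' b' := by
  unfold skew
  have : 0 ≤ 1 - ε := by linarith
  gcongr

theorem skew_add {ε q b q' : ℝ} (h0 : 0 ≤ ε) {x : ℝ} (hx : 0 ≤ x) (hq : q + x ≤ q') (h1 : ε ≤ 1) :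
    skew ε q b + (1 - ε) * x ≤ skew ε q' b := by
  unfold skew
  have h2 : 0 ≤ (1 - ε) * (q' - q - x) := mul_nonneg (by linarith) (by linarith)
  refine le_min ?_ ?_
  · refine (add_le_add (min_le_left _ _) le_rfl).trans ?_
    nlinarith
  · refine (add_le_add (min_le_right _ _) le_rfl).trans ?_
    nlinarith

open Classical in
/-- The potential of a server at the tip `p`: the value of the tree, with a penalty at each
branching where the server is on the side of larger value. Here `m` is the number of tips that the
tree may have and `ε` the strength of the penalty as a function of this number. The second term of
the minimum keeps the potential from decreasing when the other side dies: the server's side may then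
have `m` tips again. -/
noncomputable def pot (θ : ℝ) (ε : ℕ → ℝ) : BinTree → List Bool → ℕ → ℝ
  | node c, b :: p, m =>
    if (c !b).Alive then
      min (skew (ε m) (len b + (c b).pot θ ε p (m - 1)) (len (!b) + (c !b).val θ) / θ)
        (len b + (c b).pot θ ε p m)
    else len b + (c b).pot θ ε p m
  | _, _, _ => 0

section Server

variable {θ δ : ℝ} {ε : ℕ → ℝ}

theorem pot_node_both {c : Bool → BinTree} {b : Bool} (h : (c !b).Alive) (p : List Bool) (m : ℕ) :
    (node c).pot θ ε (b :: p) m =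
      min (skew (ε m) (len b + (c b).pot θ ε p (m - 1)) (len (!b) + (c !b).val θ) / θ)
        (len b + (c b).pot θ ε p m) := by
  simp [pot, h]

theorem pot_node_single {c : Bool → BinTree} {b : Bool} (h : ¬ (c !b).Alive) (p : List Bool)
    (m : ℕ) : (node c).pot θ ε (b :: p) m = len b + (c b).pot θ ε p m := by
  simp [pot, h]

theorem pot_node_le (c : Bool → BinTree) (b : Bool) (p : List Bool) (m : ℕ) :
    (node c).pot θ ε (b :: p) m ≤ len b + (c b).pot θ ε p m := by
  by_cases h : (c !b).Alive
  · rw [pot_node_both h]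
    exact min_le_right _ _
  · rw [pot_node_single h]

/-- Each tree has a stable tip without penalties: descend to the side of smaller value. -/
theorem exists_best (hδ : 0 < δ) (hθ : θ = 2 + δ) {T : BinTree} (hT : T.Alive) :
    ∃ p, T.IsTip p ∧ T.Stable θ δ p ∧ ∀ m, (∀ i, 0 ≤ ε i) → T.pot θ ε p m = T.val θ := by
  have hθ0 : 0 < θ := by linarith
  induction T with
  | empty => exact hT.elim
  | tip => exact ⟨[], trivial, trivial, fun m _ => rfl⟩
  | node c ih =>
    have key : ∃ b, (c b).Alive ∧
        ((c !b).Alive → len b + (c b).val θ ≤ len (!b) + (c !b).val θ) := by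
      by_cases h0 : (c false).Alive
      · by_cases h1 : (c true).Alive
        · rcases le_total (len false + (c false).val θ) (len true + (c true).val θ) with h | h
          · exact ⟨false, h0, fun _ => h⟩
          · exact ⟨true, h1, fun _ => h⟩
        · exact ⟨false, h0, fun h => absurd h h1⟩
      · obtain ⟨b, hb⟩ := hT
        cases b
        · exact absurd hb h0
        · exact ⟨true, hb, fun h => absurd h h0⟩
    obtain ⟨b, hb, hle⟩ := key
    obtain ⟨p, hp, hs, hpot⟩ := ih b hb
    have h1 : 0 ≤ len (!b) + (c !b).val θ := add_nonneg (len_nonneg _) (val_nonneg hθ0 _)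
    refine ⟨b :: p, hp, ⟨hs, fun h => (hle h).trans (by nlinarith)⟩, fun m hε => ?_⟩
    by_cases h : (c !b).Alive
    · have h2 := hle h
      have h3 := mul_nonneg (hε m) (sub_nonneg.2 h2)
      rw [pot_node_both h, val_node_both θ b hb h, hpot _ hε, hpot _ hε, merge, min_eq_left h2, skew,
        min_eq_left (a := len b + (c b).val θ + (len (!b) + (c !b).val θ)) (by linarith)]
    · rw [pot_node_single h, val_node_single θ b hb h, hpot _ hε]

theorem pot_le_val (hδ : 0 < δ) (hθ : θ = 2 + δ) {T : BinTree} {p : List Bool}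
    (hp : T.IsTip p) (hs : T.Stable θ δ p) (m : ℕ) : T.pot θ ε p m ≤ T.val θ := by
  have hθ0 : 0 < θ := by linarith
  induction T generalizing p m with
  | empty => simp [IsTip] at hp
  | tip => cases p <;> simp [IsTip, pot, val] at *
  | node c ih =>
    cases p with
    | nil => simp [IsTip] at hp
    | cons b p =>
      have hA : (c b).Alive := IsTip.alive (p := p) hp
      by_cases h : (c !b).Alive
      · rw [pot_node_both h, val_node_both θ b hA h]
        have h1 := ih b (p := p) hp hs.1 (m - 1)
        have h2 := ih b (p := p) hp hs.1 m
        have h3 := hs.2 h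
        refine le_min ?_ (le_min ?_ ?_)
        · refine (min_le_left _ _).trans ?_
          gcongr
          refine (min_le_left _ _).trans ?_
          linarith
        · refine (min_le_right _ _).trans ?_
          linarith
        · refine (min_le_left _ _).trans ?_
          have e (x : ℝ) : x * θ = x * 2 + x * δ := by rw [hθ]; ring
          rw [div_le_iff₀ hθ0, e]
          refine (min_le_left _ _).trans ?_
          linarith
      · rw [pot_node_single h, val_node_single θ b hA h]
        linarith [ih b (p := p) hp hs.1 m]

theorem pathLen_le_val (hδ : 0 < δ) (hθ : θ = 2 + δ) {T : BinTree} {p : List Bool}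
    (hp : T.IsTip p) (hs : T.Stable θ δ p) {m : ℕ} (hm : T.tips ≤ m) :
    pathLen p ≤ (1 + δ) ^ m * T.val θ := by
  have hθ0 : 0 < θ := by linarith
  induction T generalizing p m with
  | empty => simp [IsTip] at hp
  | tip => cases p <;> simp [IsTip, pathLen, val] at *
  | node c ih =>
    cases p with
    | nil => simp [IsTip] at hp
    | cons b p =>
      have hA : (c b).Alive := IsTip.alive (p := p) hp
      have ht := tips_add c b
      have hpow (i : ℕ) : 1 ≤ (1 + δ) ^ i := one_le_pow₀ (by linarith)
      have hl := len_nonneg b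
      simp only [pathLen]
      by_cases h : (c !b).Alive
      · have h1 := h.tips_pos
        obtain ⟨i, rfl⟩ : ∃ i, m = i + 1 := ⟨m - 1, by omega⟩
        have h2 := ih b (p := p) hp hs.1 (m := i) (by omega)
        have h3 := hs.2 h
        have hv := val_nonneg hθ0 (c b)
        set a := len b + (c b).val θ with ha
        have hval : a ≤ (1 + δ) * (node c).val θ := by
          rw [val_node_both θ b hA h, merge]
          have h4 : a / (1 + δ) ≤ min ((a + (len (!b) + (c !b).val θ)) / θ)
              (min a (len (!b) + (c !b).val θ)) := by
            have h5 : a / (1 + δ) ≤ len (!b) + (c !b).val θ := by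
              rw [div_le_iff₀ (by linarith)]
              linarith
            refine le_min ?_ (le_min ?_ h5)
            · have e (x : ℝ) : x * θ = x + x * (1 + δ) := by rw [hθ]; ring
              rw [le_div_iff₀ hθ0, e]
              have : a / (1 + δ) * (1 + δ) = a := div_mul_cancel₀ _ (by linarith)
              linarith
            · exact div_le_self (by linarith) (by linarith)
          rw [div_le_iff₀ (by linarith)] at h4
          linarith
        have h6 : len b + pathLen p ≤ (1 + δ) ^ i * a := by
          rw [ha, mul_add]
          have := mul_le_mul_of_nonneg_right (hpow i) hl
          linarith
        refine h6.trans ?_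
        rw [pow_succ, mul_assoc]
        exact mul_le_mul_of_nonneg_left hval (by positivity)
      · rw [val_node_single θ b hA h, mul_add]
        have h2 := ih b (p := p) hp hs.1 (m := m) (by omega)
        have := mul_le_mul_of_nonneg_right (hpow m) hl
        linarith

end Server

section Move

variable {θ δ H : ℝ} {ε c : ℕ → ℝ} {w : ℕ}

/-- Moving from the side of `p` to a tip `q` of the other side that carries no penalty is paid for
by the growth of the potential, which is at least `ε m * δ / θ` times the value of that other
side, whether `p` is given up because it is dead or because it is no longer stable. -/
theorem pot_add_le_of_switch (hδ : 0 < δ) (hθ : θ = 2 + δ) (hε0 : ∀ m, 0 ≤ ε m)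
    (hε1 : ∀ m, ε m ≤ 1) (hH : ∀ m ≤ w, (1 + δ) ^ m ≤ H) (hc0 : ∀ m, 0 ≤ c m)
    (hc : ∀ m, c m * (H * θ ^ 2) ≤ ε m * δ)
    {t : Bool → BinTree} {b : Bool} {p : List Bool}
    (hp : (t b).IsTip p) (hs : (node t).Stable θ δ (b :: p)) (hB : (t !b).Alive)
    {B' : BinTree} (hBB' : (t !b).val θ ≤ B'.val θ) {q : List Bool} (hq : B'.IsTip q)
    (hqs : B'.Stable θ δ q) {m : ℕ} (hmw : m ≤ w) (hm : (node t).tips ≤ m) (hm' : B'.tips ≤ m) :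
    (node t).pot θ ε (b :: p) m + c m * pathDist (b :: p) ((!b) :: q) ≤ len (!b) + B'.val θ := by
  have hθ0 : 0 < θ := by linarith
  have ht := tips_add t b
  have hpow (i : ℕ) : 1 ≤ (1 + δ) ^ i := one_le_pow₀ (by linarith)
  have hH1 : 1 ≤ H := (hpow 0).trans (hH 0 (Nat.zero_le _))
  set a := len b + (t b).val θ with ha
  set β := len (!b) + (t !b).val θ with hβ
  set β' := len (!b) + B'.val θ with hβ'
  have hββ' : β ≤ β' := by rw [hβ, hβ']; linarith
  have haβ : a ≤ (1 + δ) * β' := (hs.2 hB).trans (mul_le_mul_of_nonneg_left hββ' (by linarith))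
  have hβ0 : 0 ≤ β' := add_nonneg (len_nonneg _) (val_nonneg hθ0 _)
  have hd1 : pathLen (b :: p) ≤ H * a := by
    have h1 := pathLen_le_val hδ hθ (p := p) hp hs.1 (m := m) (by omega)
    have h2 := mul_le_mul_of_nonneg_right (hH m hmw) (val_nonneg hθ0 (t b))
    have h3 := mul_le_mul_of_nonneg_right hH1 (len_nonneg b)
    simp only [pathLen]
    rw [ha, mul_add]
    linarith
  have hd2 : pathLen ((!b) :: q) ≤ H * β' := by
    have h1 := pathLen_le_val hδ hθ hq hqs hm'
    have h2 := mul_le_mul_of_nonneg_right (hH m hmw) (val_nonneg hθ0 B')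
    have h3 := mul_le_mul_of_nonneg_right hH1 (len_nonneg (!b))
    simp only [pathLen]
    rw [hβ', mul_add]
    linarith
  have hdist : pathDist (b :: p) ((!b) :: q) = pathLen (b :: p) + pathLen ((!b) :: q) := by
    simp [pathDist]
  have hd : pathDist (b :: p) ((!b) :: q) ≤ H * θ * β' := by
    have h1 : H * a ≤ H * ((1 + δ) * β') := mul_le_mul_of_nonneg_left haβ (by linarith)
    have h2 : H * θ * β' = H * ((1 + δ) * β') + H * β' := by rw [hθ]; ring
    rw [hdist, h2]
    linarith
  have hpot : (node t).pot θ ε (b :: p) m ≤ skew (ε m) ((1 + δ) * β') β' / θ := by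
    rw [pot_node_both hB]
    refine (min_le_left _ _).trans ?_
    gcongr
    refine skew_mono (hε0 m) (hε1 m) ?_ hββ'
    have := pot_le_val (ε := ε) hδ hθ (p := p) hp hs.1 (m - 1)
    linarith
  have hskew : skew (ε m) ((1 + δ) * β') β' ≤ θ * β' - ε m * δ * β' := by
    refine (min_le_right _ _).trans (le_of_eq ?_)
    rw [hθ]
    ring
  have hcost : c m * pathDist (b :: p) ((!b) :: q) ≤ ε m * δ * β' / θ := by
    refine (mul_le_mul_of_nonneg_left hd (hc0 m)).trans ?_
    rw [le_div_iff₀ hθ0]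
    have := mul_le_mul_of_nonneg_right (hc m) hβ0
    nlinarith
  have h3 : skew (ε m) ((1 + δ) * β') β' / θ ≤ β' - ε m * δ * β' / θ := by
    rw [div_le_iff₀ hθ0, sub_mul, div_mul_cancel₀ _ hθ0.ne']
    linarith
  linarith

/-- When the tree evolves, the server can move from a stable tip to a stable tip of the new tree so
that the growth of its potential pays for the move. -/
theorem exists_move (hδ : 0 < δ) (hθ : θ = 2 + δ) (hε0 : ∀ m, 0 ≤ ε m)
    (hε1 : ∀ m, ε m ≤ 1) (hH : ∀ m ≤ w, (1 + δ) ^ m ≤ H) (hc0 : ∀ m, 0 ≤ c m)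
    (hc : ∀ m, c m * (H * θ ^ 2) ≤ ε m * δ)
    (hcs : ∀ m, c (m + 1) * θ ≤ (1 - ε (m + 1)) * c m)
    {T T' : BinTree} (h : Evolve T T') (hT' : T'.Alive) {p : List Bool} (hp : T.IsTip p)
    (hs : T.Stable θ δ p) :
    ∃ p', T'.IsTip p' ∧ T'.Stable θ δ p' ∧ ∀ m ≤ w, T.tips ≤ m → T'.tips ≤ m →
      T.pot θ ε p m + c m * pathDist p p' ≤ T'.pot θ ε p' m := by
  have hθ0 : 0 < θ := by linarith
  have hpow (i : ℕ) : 1 ≤ (1 + δ) ^ i := one_le_pow₀ (by linarith)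
  have hH1 : 1 ≤ H := (hpow 0).trans (hH 0 (Nat.zero_le _))
  induction h generalizing p with
  | grow T' =>
    obtain ⟨q, hq, hqs, hpot⟩ := exists_best (ε := ε) hδ hθ hT'
    refine ⟨q, hq, hqs, fun m hmw _ hm => ?_⟩
    cases p with
    | cons b p => simp [IsTip] at hp
    | nil =>
      have hd : pathDist [] q = pathLen q := by cases q <;> rfl
      have h1 := (pathLen_le_val hδ hθ hq hqs hm).trans
        (mul_le_mul_of_nonneg_right (hH m hmw) (val_nonneg hθ0 T'))
      have h2 : c m * H ≤ 1 := by
        have h3 : c m * H * θ ^ 2 ≤ 1 * θ ^ 2 := by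
          have h4 : ε m * δ ≤ 1 * δ := mul_le_mul_of_nonneg_right (hε1 m) hδ.le
          have := hc m
          nlinarith
        exact le_of_mul_le_mul_right h3 (by positivity)
      have h3 := mul_le_mul_of_nonneg_left h1 (hc0 m)
      have h4 := mul_le_mul_of_nonneg_right h2 (val_nonneg hθ0 T')
      have h5 : (tip.pot θ ε [] m : ℝ) = 0 := rfl
      rw [hpot m hε0, hd, h5]
      nlinarith
  | dead T T' h => exact absurd hT' h
  | node t t' h ih =>
    cases p with
    | nil => simp [IsTip] at hp
    | cons b p =>
      have hp' : (t b).IsTip p := hp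
      have htips := tips_add t b
      have htips' := tips_add t' b
      by_cases hB' : (t' !b).Alive
      · have hB := (h !b).alive hB'
        have hval := (h !b).val_mono hθ0 hB'
        have hA := hp'.alive
        set a' := len b + (t' b).val θ with ha'
        set β' := len (!b) + (t' !b).val θ with hβ'
        have hβ0 : 0 ≤ β' := add_nonneg (len_nonneg _) (val_nonneg hθ0 _)
        by_cases hstay : (t' b).Alive ∧ a' ≤ (1 + δ) * β'
        · obtain ⟨hA', hle⟩ := hstay
          obtain ⟨p', hp1, hp2, hp3⟩ := ih b hA' hp' hs.1
          refine ⟨b :: p', hp1, ⟨hp2, fun _ => hle⟩, fun m hmw hm hm' => ?_⟩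
          have hd : pathDist (b :: p) (b :: p') = pathDist p p' := by simp [pathDist]
          have hdn := pathDist_nonneg p p'
          have h1 := hB.tips_pos
          have h2 := hB'.tips_pos
          obtain ⟨i, rfl⟩ : ∃ i, m = i + 1 := ⟨m - 1, by omega⟩
          have q1 := hp3 i (by omega) (by omega) (by omega)
          have q2 := hp3 (i + 1) hmw (by omega) (by omega)
          rw [hd, pot_node_both hB, pot_node_both hB', Nat.add_sub_cancel]
          refine le_min ?_ ?_
          · refine (add_le_add (min_le_left _ _) le_rfl).trans ?_
            have q3 := skew_add (b := len (!b) + (t !b).val θ) (hε0 (i + 1))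
              (mul_nonneg (hc0 i) hdn)
              (q := len b + (t b).pot θ ε p i) (q' := len b + (t' b).pot θ ε p' i)
              (by linarith) (hε1 (i + 1))
            have q4 := skew_mono (q := len b + (t' b).pot θ ε p' i) (hε0 (i + 1)) (hε1 (i + 1))
              le_rfl (add_le_add (le_refl (len (!b))) hval)
            have q5 := mul_le_mul_of_nonneg_right (hcs i) hdn
            rw [le_div_iff₀ hθ0, add_mul, div_mul_cancel₀ _ hθ0.ne']
            linarith
          · refine (add_le_add (min_le_right _ _) le_rfl).trans ?_
            linarith
        · obtain ⟨q, hq, hqs, hpot⟩ := exists_best (ε := ε) hδ hθ hB'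
          have hbig (hA' : (t' b).Alive) : (1 + δ) * β' < a' := by
            by_contra hle
            exact hstay ⟨hA', not_lt.1 hle⟩
          refine ⟨(!b) :: q, hq, ⟨hqs, fun hA' => ?_⟩, fun m hmw hm hm' => ?_⟩
          · rw [Bool.not_not] at hA' ⊢
            have h1 := hbig hA'
            have h2 : β' ≤ a' := by nlinarith
            change β' ≤ (1 + δ) * a'
            nlinarith
          · refine (pot_add_le_of_switch hδ hθ hε0 hε1 hH hc0 hc hp' hs hB hval hq hqs hmw hm
              (by omega)).trans ?_
            by_cases hA' : (t' b).Alive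
            · have h1 := hbig hA'
              rw [pot_node_both (by simpa using hA'), hpot _ hε0, hpot _ hε0, Bool.not_not]
              refine le_min ?_ le_rfl
              rw [le_div_iff₀ hθ0]
              have e : β' * θ = β' + (1 + δ) * β' := by rw [hθ]; ring
              have h2 : β' ≤ a' := by nlinarith
              refine le_min ?_ ?_
              · linarith
              · nlinarith [mul_nonneg (hε0 m) (sub_nonneg.2 h2)]
            · rw [pot_node_single (by simpa using hA'), hpot _ hε0]
      · have hA' : (t' b).Alive := ((alive_node t' b).1 hT').resolve_right hB'
        obtain ⟨p', hp1, hp2, hp3⟩ := ih b hA' hp' hs.1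
        refine ⟨b :: p', hp1, ⟨hp2, fun h => absurd h hB'⟩, fun m hmw hm hm' => ?_⟩
        have q2 := hp3 m hmw (by omega) (by omega)
        have hd : pathDist (b :: p) (b :: p') = pathDist p p' := by simp [pathDist]
        rw [hd, pot_node_single hB']
        exact (add_le_add (pot_node_le t b p m) le_rfl).trans (by linarith)

end Move

end BinTree

/-! ### Layers as binary trees -/

namespace BinTree

/-- The words of `P` that start with `b`, without this first letter. -/
noncomputable def sub (b : Bool) (P : Finset (List Bool)) : Finset (List Bool) :=
  P.preimage (List.cons b) List.cons_injective.injOn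

theorem mem_sub {b : Bool} {P : Finset (List Bool)} {p : List Bool} :
    p ∈ sub b P ↔ b :: p ∈ P := by
  rw [sub, Finset.mem_preimage]

/-- The shape of a set of words of length at most `n`; only the words without a proper prefix in
the set matter. -/
noncomputable def shape : ℕ → Finset (List Bool) → BinTree
  | 0, P => if [] ∈ P then tip else empty
  | n + 1, P =>
    if [] ∈ P then tip else if P = ∅ then empty else node fun b => shape n (sub b P)

theorem shape_add (k : ℕ) {n : ℕ} {P : Finset (List Bool)} (h : ∀ p ∈ P, p.length ≤ n) :
    shape (n + k) P = shape n P := by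
  induction n generalizing P with
  | zero =>
    cases k with
    | zero => rfl
    | succ k =>
      rw [Nat.zero_add]
      unfold shape
      by_cases h0 : [] ∈ P
      · simp [h0]
      · have : P = ∅ := by
          refine Finset.eq_empty_of_forall_notMem fun p hp => ?_
          have := List.length_eq_zero_iff.1 (Nat.le_zero.1 (h p hp))
          exact h0 (this ▸ hp)
        simp [this]
  | succ n ih =>
    rw [Nat.add_right_comm]
    unfold shape
    have (b : Bool) : shape (n + k) (sub b P) = shape n (sub b P) :=
      ih fun p hp => by simpa using h _ (mem_sub.1 hp)
    simp only [this]

theorem IsTip.mem_of_shape {n : ℕ} {P : Finset (List Bool)} {p : List Bool}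
    (h : (shape n P).IsTip p) : p ∈ P := by
  induction n generalizing P p with
  | zero =>
    unfold shape at h
    split_ifs at h with h0
    · cases p
      · exact h0
      · simp [IsTip] at h
    · simp [IsTip] at h
  | succ n ih =>
    unfold shape at h
    split_ifs at h with h0 h1
    · cases p
      · exact h0
      · simp [IsTip] at h
    · simp [IsTip] at h
    · cases p with
      | nil => simp [IsTip] at h
      | cons b p => exact mem_sub.1 (ih h)

theorem alive_shape {n : ℕ} {P : Finset (List Bool)} (hn : ∀ p ∈ P, p.length ≤ n)
    (h : P.Nonempty) : (shape n P).Alive := by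
  induction n generalizing P with
  | zero =>
    obtain ⟨p, hp⟩ := h
    have h0 := List.length_eq_zero_iff.1 (Nat.le_zero.1 (hn p hp))
    subst h0
    simp [shape, hp, Alive]
  | succ n ih =>
    unfold shape
    split_ifs with h0 h1
    · trivial
    · exact absurd h1 h.ne_empty
    · obtain ⟨p, hp⟩ := h
      cases p with
      | nil => exact absurd hp h0
      | cons b p =>
        exact ⟨b, ih (fun q hq => by simpa using hn _ (mem_sub.1 hq)) ⟨p, mem_sub.2 hp⟩⟩

theorem tips_shape_le (n : ℕ) (P : Finset (List Bool)) : (shape n P).tips ≤ P.card := by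
  induction n generalizing P with
  | zero =>
    unfold shape
    split_ifs with h0
    · exact Finset.card_pos.2 ⟨_, h0⟩
    · exact Nat.zero_le _
  | succ n ih =>
    unfold shape
    split_ifs with h0 h1
    · exact Finset.card_pos.2 ⟨_, h0⟩
    · exact Nat.zero_le _
    · have hc (b : Bool) : ((sub b P).image (List.cons b)).card = (sub b P).card :=
        Finset.card_image_of_injective _ (List.cons_injective)
      have hd : Disjoint ((sub false P).image (List.cons false))
          ((sub true P).image (List.cons true)) := by
        rw [Finset.disjoint_left]
        intro p hp hp'
        rw [Finset.mem_image] at hp hp'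
        obtain ⟨q, _, rfl⟩ := hp
        obtain ⟨q', _, h⟩ := hp'
        simp at h
      have hs : (sub false P).image (List.cons false) ∪ (sub true P).image (List.cons true) ⊆ P := by
        intro p hp
        rw [Finset.mem_union, Finset.mem_image, Finset.mem_image] at hp
        rcases hp with ⟨q, hq, rfl⟩ | ⟨q, hq, rfl⟩ <;> exact mem_sub.1 hq
      have := Finset.card_le_card hs
      rw [Finset.card_union_of_disjoint hd, hc, hc] at this
      exact (Nat.add_le_add (ih _) (ih _)).trans this

theorem evolve_shape (n : ℕ) {P P' : Finset (List Bool)}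
    (h : ∀ p' ∈ P', ∃ p ∈ P, p <+: p') : Evolve (shape n P) (shape n P') := by
  induction n generalizing P P' with
  | zero =>
    by_cases h0 : [] ∈ P
    · simpa [shape, h0] using Evolve.grow _
    · have h1 : [] ∉ P' := fun h' => by
        obtain ⟨p, hp, hpp⟩ := h _ h'
        exact h0 (List.prefix_nil.1 hpp ▸ hp)
      exact Evolve.dead _ _ (by simp [shape, h1, Alive])
  | succ n ih =>
    by_cases h0 : [] ∈ P
    · simpa [shape, h0] using Evolve.grow _
    · have h1 : [] ∉ P' := fun h' => by
        obtain ⟨p, hp, hpp⟩ := h _ h'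
        exact h0 (List.prefix_nil.1 hpp ▸ hp)
      by_cases h2 : P' = ∅
      · exact Evolve.dead _ _ (by simp [shape, h2, Alive])
      · have h3 : P ≠ ∅ := fun h' => by
          obtain ⟨p', hp'⟩ := Finset.nonempty_iff_ne_empty.2 h2
          obtain ⟨p, hp, _⟩ := h _ hp'
          simp [h'] at hp
        simp only [shape, h0, h1, h2, h3, if_false]
        refine Evolve.node _ _ fun b => ih fun p' hp' => ?_
        obtain ⟨p, hp, hpp⟩ := h _ (mem_sub.1 hp')
        cases p with
        | nil => exact absurd hp h0
        | cons b' p =>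
          obtain ⟨rfl, hq⟩ := List.cons_prefix_cons.1 hpp
          exact ⟨p, mem_sub.2 hp, hq⟩

/-- The word of a node: port `a` is written in unary, as `a` letters `true` and one letter `false`.
Thus only the letter `false` stands for an edge of the tree, whence the edge lengths `len`. -/
def code : Node → List Bool
  | [] => []
  | a :: u => List.replicate a true ++ false :: code u

theorem code_zero (u : Node) : code (0 :: u) = false :: code u := rfl

theorem code_succ (a : ℕ) (u : Node) : code ((a + 1) :: u) = true :: code (a :: u) := rfl

theorem code_append (u v : Node) : code (u ++ v) = code u ++ code v := by
  induction u with
  | nil => rfl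
  | cons a u ih => simp [code, ih]

theorem code_prefix {u v : Node} (h : u <+: v) : code u <+: code v := by
  obtain ⟨r, rfl⟩ := h
  exact ⟨code r, (code_append u r).symm⟩

theorem pathLen_code_cons (a : ℕ) (u : Node) :
    pathLen (code (a :: u)) = 1 + pathLen (code u) := by
  induction a with
  | zero => simp [code_zero, pathLen, len]
  | succ a ih => simp [code_succ, pathLen, len, ih]

theorem pathLen_code (u : Node) : pathLen (code u) = u.length := by
  induction u with
  | nil => simp [code, pathLen]
  | cons a u ih =>
    rw [pathLen_code_cons, ih]
    push_cast [List.length_cons]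
    ring

theorem dist_cons_cons (a : ℕ) (u v : Node) : Node.dist (a :: u) (a :: v) = Node.dist u v := by
  simp only [Node.dist, Node.lca, if_true, List.length_cons]
  omega

theorem pathDist_code_cons (a : ℕ) (u v : Node) :
    pathDist (code (a :: u)) (code (a :: v)) = pathDist (code u) (code v) := by
  induction a with
  | zero => simp [code_zero, pathDist]
  | succ a ih => simp [code_succ, pathDist, ih]

theorem pathDist_code_of_ne {a b : ℕ} (h : a ≠ b) (u v : Node) :
    pathDist (code (a :: u)) (code (b :: v)) =
      pathLen (code (a :: u)) + pathLen (code (b :: v)) := by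
  induction a generalizing b with
  | zero =>
    cases b with
    | zero => exact absurd rfl h
    | succ b => simp [code_zero, code_succ, pathDist]
  | succ a ih =>
    cases b with
    | zero => simp [code_zero, code_succ, pathDist]
    | succ b =>
      have := ih (b := b) (by omega)
      simp only [code_succ, pathDist, if_true, this, pathLen, len]
      ring

theorem dist_eq_pathDist (u v : Node) : (Node.dist u v : ℝ) = pathDist (code u) (code v) := by
  induction u generalizing v with
  | nil =>
    have : pathDist (code []) (code v) = pathLen (code v) := by
      cases h : code v <;> rfl
    rw [this, pathLen_code]
    simp [Node.dist, Node.lca]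
  | cons a u ih =>
    cases v with
    | nil =>
      have : pathDist (code (a :: u)) (code []) = pathLen (code (a :: u)) := by
        cases h : code (a :: u) <;> rfl
      rw [this, pathLen_code]
      simp [Node.dist, Node.lca]
    | cons b v =>
      by_cases h : a = b
      · subst h
        rw [dist_cons_cons, pathDist_code_cons, ih]
      · rw [pathDist_code_of_ne h, pathLen_code, pathLen_code]
        simp [Node.dist, Node.lca, h]

/-- The binary tree of a layer. -/
noncomputable def ofLayer (S : Finset Node) : BinTree :=
  shape ((S.image code).sup List.length) (S.image code)

theorem ofLayer_eq {S : Finset Node} {n : ℕ} (h : (S.image code).sup List.length ≤ n) :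
    ofLayer S = shape n (S.image code) := by
  obtain ⟨k, rfl⟩ := Nat.exists_eq_add_of_le h
  exact (shape_add k fun p hp => Finset.le_sup (f := List.length) hp).symm

theorem evolve_ofLayer {S S' : Finset Node} (h : ∀ v ∈ S', ∃ u ∈ S, u <+: v) :
    Evolve (ofLayer S) (ofLayer S') := by
  rw [ofLayer_eq (le_max_left _ ((S'.image code).sup List.length)),
    ofLayer_eq (S := S') (le_max_right ((S.image code).sup List.length) _)]
  refine evolve_shape _ fun p' hp' => ?_
  obtain ⟨v, hv, rfl⟩ := Finset.mem_image.1 hp'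
  obtain ⟨u, hu, huv⟩ := h v hv
  exact ⟨code u, Finset.mem_image_of_mem _ hu, code_prefix huv⟩

theorem alive_ofLayer {S : Finset Node} (h : S.Nonempty) : (ofLayer S).Alive :=
  alive_shape (fun _ hp => Finset.le_sup (f := List.length) hp) (h.image _)

theorem tips_ofLayer_le (S : Finset Node) : (ofLayer S).tips ≤ S.card :=
  (tips_shape_le _ _).trans Finset.card_image_le

theorem ofLayer_root : ofLayer {[]} = tip := by
  simp [ofLayer, code, shape]

end BinTree

/-! ### A traversal algorithm -/

namespace Traversal

open BinTree

/-- Parameter of stability for width `w`. -/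
noncomputable def slack (w : ℕ) : ℝ := 1 / w

/-- Discount factor of the value for width `w`. -/
noncomputable def disc (w : ℕ) : ℝ := 2 + slack w

/-- Inverse of the strength of the penalty. Its recursion is what `exists_move` requires, with
equality. -/
noncomputable def invPenalty (w : ℕ) : ℕ → ℝ
  | 0 => 1
  | m + 1 => disc w * invPenalty w m + 1

/-- Strength of the penalty at a branching with at most `m` tips. -/
noncomputable def penalty (w m : ℕ) : ℝ := 1 / invPenalty w m

/-- Growth of the potential per unit of movement. -/
noncomputable def rate (w m : ℕ) : ℝ := slack w / (3 * disc w ^ 2 * invPenalty w m)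

theorem slack_pos {w : ℕ} (hw : 1 ≤ w) : 0 < slack w :=
  one_div_pos.2 (by exact_mod_cast hw)

theorem disc_pos (w : ℕ) : 2 ≤ disc w := by
  have : 0 ≤ slack w := by unfold slack; positivity
  unfold disc
  linarith

theorem one_le_invPenalty (w m : ℕ) : 1 ≤ invPenalty w m := by
  induction m with
  | zero => exact le_rfl
  | succ m ih =>
    have := disc_pos w
    simp only [invPenalty]
    nlinarith

theorem invPenalty_le (w m : ℕ) : invPenalty w m + 1 ≤ 2 * disc w ^ m := by
  induction m with
  | zero => norm_num [invPenalty]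
  | succ m ih =>
    have := disc_pos w
    simp only [invPenalty, pow_succ]
    nlinarith

theorem one_add_slack_pow_le {w m : ℕ} (hm : m ≤ w) : (1 + slack w) ^ m ≤ 3 := by
  have h0 : 0 ≤ slack w := by unfold slack; positivity
  have h1 : 1 + slack w ≤ Real.exp (slack w) := by
    linarith [Real.add_one_le_exp (slack w)]
  calc (1 + slack w) ^ m ≤ (1 + slack w) ^ w := pow_le_pow_right₀ (by linarith) hm
    _ ≤ Real.exp (slack w) ^ w := pow_le_pow_left₀ (by linarith) h1 w
    _ = Real.exp (w * slack w) := by rw [← Real.exp_nat_mul]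
    _ ≤ Real.exp 1 := Real.exp_le_exp.2 (by rw [slack, mul_one_div]; exact div_self_le_one _)
    _ ≤ 3 := by linarith [Real.exp_one_lt_d9]

/-- At level `w`, the rate is of the order of `1 / (w * 2 ^ w)`. -/
theorem one_le_rate {w : ℕ} (hw : 1 ≤ w) : 1 ≤ rate w w * (162 * (w * 2 ^ w)) := by
  have hw' : (1 : ℝ) ≤ w := by exact_mod_cast hw
  have h1 := one_le_invPenalty w w
  have h2 := disc_pos w
  have h3 : disc w ≤ 3 := by
    have : slack w ≤ 1 := by unfold slack; rw [div_le_one] <;> linarith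
    unfold disc
    linarith
  have h4 : invPenalty w w ≤ 6 * 2 ^ w := by
    have h5 : disc w ≤ 2 * (1 + slack w) := by
      have := (slack_pos hw).le
      unfold disc
      linarith
    have h6 : disc w ^ w ≤ 2 ^ w * (1 + slack w) ^ w := by
      rw [← mul_pow]
      exact pow_le_pow_left₀ (by linarith) h5 w
    have h7 := mul_le_mul_of_nonneg_left (one_add_slack_pow_le (le_refl w))
      (pow_nonneg (zero_le_two (α := ℝ)) w)
    linarith [invPenalty_le w w]
  have h5 : 3 * disc w ^ 2 * invPenalty w w ≤ 27 * (6 * 2 ^ w) := by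
    have h9 : 3 * disc w ^ 2 ≤ 27 := by nlinarith
    exact mul_le_mul h9 h4 (by linarith) (by norm_num)
  have e : slack w * w = 1 := by unfold slack; field_simp
  rw [rate, div_mul_eq_mul_div, one_le_div (by positivity)]
  calc _ ≤ _ := h5
    _ = (slack w * w) * (162 * 2 ^ w) := by rw [e]; ring
    _ = _ := by ring

/-- What the algorithm wants of its move from `s` to `s'` when the layer `S` is followed by `S'`. -/
def GoodMove (w : ℕ) (S S' : Finset Node) (s s' : Node) : Prop :=
  s' ∈ S' ∧ (ofLayer S').IsTip (code s') ∧ (ofLayer S').Stable (disc w) (slack w) (code s') ∧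
    (ofLayer S).pot (disc w) (penalty w) (code s) w + rate w w * Node.dist s s' ≤
      (ofLayer S').pot (disc w) (penalty w) (code s') w

theorem exists_goodMove {w : ℕ} (hw : 1 ≤ w) {S S' : Finset Node} (hS' : S'.Nonempty)
    (hc : S.card ≤ w) (hc' : S'.card ≤ w) (h : ∀ v ∈ S', ∃ u ∈ S, u <+: v) {s : Node}
    (hs : (ofLayer S).IsTip (code s)) (hst : (ofLayer S).Stable (disc w) (slack w) (code s)) :
    ∃ s', GoodMove w S S' s s' := by
  have h1 := one_le_invPenalty w
  have h2 := disc_pos w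
  have h3 := slack_pos hw
  obtain ⟨p, hp, hps, hpot⟩ := exists_move (θ := disc w) (δ := slack w) (H := 3)
    (ε := penalty w) (c := rate w) (w := w) h3 rfl
    (fun m => one_div_nonneg.2 (by linarith [h1 m]))
    (fun m => div_le_one_of_le₀ (h1 m) (by linarith [h1 m]))
    (fun m hm => one_add_slack_pow_le hm)
    (fun m => by have := h1 m; unfold rate; positivity)
    (fun m => by
      have := h1 m
      unfold rate penalty
      apply le_of_eq
      field_simp)
    (fun m => by
      have h4 := h1 m
      have h5 := h1 (m + 1)
      have h6 : 1 - penalty w (m + 1) = disc w * invPenalty w m / invPenalty w (m + 1) := by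
        rw [penalty, eq_div_iff (by linarith), sub_mul, one_div_mul_cancel (by linarith)]
        simp only [invPenalty]
        ring
      rw [h6]
      unfold rate
      apply le_of_eq
      field_simp)
    (evolve_ofLayer h) (alive_ofLayer hS') hs hst
  obtain ⟨s', hs', rfl⟩ := Finset.mem_image.1 hp.mem_of_shape
  refine ⟨s', hs', hp, hps, ?_⟩
  rw [dist_eq_pathDist]
  exact hpot w le_rfl ((tips_ofLayer_le S).trans hc) ((tips_ofLayer_le S').trans hc')

open Classical in
/-- The move of the algorithm: a good one if there is one, and some node of the layer otherwise. -/
noncomputable def next (w : ℕ) (x : Finset Node × Node) (S' : Finset Node) : Finset Node × Node :=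
  (S', if h : ∃ s', GoodMove w x.1 S' x.2 s' then h.choose
    else if h : S'.Nonempty then h.choose else [])

/-- The algorithm: it starts at the root, as if there were a layer that consists of the root. -/
noncomputable def algorithm (w : ℕ) (l : List (Finset Node)) : Node :=
  (l.foldl (next w) ({[]}, [])).2

theorem next_mem (w : ℕ) (x : Finset Node × Node) {S' : Finset Node} (h : S'.Nonempty) :
    (next w x S').2 ∈ S' := by
  classical
  unfold next
  dsimp only
  split_ifs with h1
  · exact h1.choose_spec.1
  · exact h.choose_spec

theorem upTo_zero (L : LayeredTree) : L.upTo 0 = [L.layer 0] := by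
  simp [LayeredTree.upTo]

theorem upTo_succ (L : LayeredTree) (t : ℕ) : L.upTo (t + 1) = L.upTo t ++ [L.layer (t + 1)] := by
  simp [LayeredTree.upTo, List.range_succ]

theorem foldl_upTo_fst (w : ℕ) (L : LayeredTree) (t : ℕ) :
    ((L.upTo t).foldl (next w) ({[]}, [])).1 = L.layer t := by
  cases t with
  | zero => simp [upTo_zero, next]
  | succ t => simp [upTo_succ, next]

theorem algorithm_isTraversal (w : ℕ) : IsTraversal w (algorithm w) := by
  intro L _ t
  cases t with
  | zero => simpa [algorithm, upTo_zero] using next_mem w _ (L.nonempty 0)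
  | succ t => simpa [algorithm, upTo_succ] using next_mem w _ (L.nonempty (t + 1))

theorem traversalCost_succ (ℓ : List (Finset Node) → Node) (L : LayeredTree) (t : ℕ) :
    traversalCost ℓ L (t + 1) =
      traversalCost ℓ L t +
        Node.dist (if t = 0 then [] else ℓ (L.upTo (t - 1))) (ℓ (L.upTo t)) := by
  rw [traversalCost, Finset.sum_range_succ, traversalCost]

theorem goodMove_next {w : ℕ} {x : Finset Node × Node} {S' : Finset Node}
    (h : ∃ s', GoodMove w x.1 S' x.2 s') : GoodMove w x.1 S' x.2 (next w x S').2 := by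
  classical
  unfold next
  dsimp only
  rw [dif_pos h]
  exact h.choose_spec

theorem cost_le_pot {w : ℕ} (hw : 1 ≤ w) {L : LayeredTree} (hL : L.WidthLE w) (t : ℕ) :
    (ofLayer (L.layer t)).IsTip (code (algorithm w (L.upTo t))) ∧
    (ofLayer (L.layer t)).Stable (disc w) (slack w) (code (algorithm w (L.upTo t))) ∧
    rate w w * traversalCost (algorithm w) L (t + 1) ≤
      (ofLayer (L.layer t)).pot (disc w) (penalty w) (code (algorithm w (L.upTo t))) w := by
  induction t with
  | zero =>
    have h := goodMove_next (x := ({[]}, [])) (exists_goodMove hw (S := {[]}) (s := []) (L.nonempty 0)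
      (by simpa using hw) (hL 0) (fun v _ => ⟨[], by simp, List.nil_prefix⟩)
      (by rw [ofLayer_root]; trivial) (by rw [ofLayer_root]; trivial))
    have e : algorithm w (L.upTo 0) = (next w ({[]}, []) (L.layer 0)).2 := by
      simp [algorithm, upTo_zero]
    rw [e]
    refine ⟨h.2.1, h.2.2.1, ?_⟩
    have h4 := h.2.2.2
    have h5 : (tip.pot (disc w) (penalty w) [] w) = 0 := rfl
    rw [ofLayer_root, show code [] = [] from rfl, h5, zero_add] at h4
    rw [traversalCost_succ]
    simpa [traversalCost, e] using h4
  | succ t ih =>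
    have h := goodMove_next (exists_goodMove hw (L.nonempty (t + 1)) (hL t) (hL (t + 1))
      (L.descends t) ih.1 ih.2.1) (x := (L.layer t, algorithm w (L.upTo t)))
    have e : algorithm w (L.upTo (t + 1)) =
        (next w (L.layer t, algorithm w (L.upTo t)) (L.layer (t + 1))).2 := by
      have : (L.layer t, algorithm w (L.upTo t)) = (L.upTo t).foldl (next w) ({[]}, []) :=
        Prod.ext (foldl_upTo_fst w L t).symm rfl
      rw [this]
      simp [algorithm, upTo_succ]
    rw [e]
    refine ⟨h.2.1, h.2.2.1, ?_⟩
    have h4 := h.2.2.2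
    rw [traversalCost_succ, e]
    push_cast
    dsimp only at h4
    rw [mul_add]
    linarith [ih.2.2]

/-- There are `O(w * 2 ^ w)`-competitive deterministic traversal algorithms of width `w`. -/
theorem algorithm_isCompetitive {w : ℕ} (hw : 1 ≤ w) :
    IsCompetitive w (162 * (w * 2 ^ w)) (algorithm w) := by
  refine ⟨algorithm_isTraversal w, fun L D hL hD t => ?_⟩
  cases t with
  | zero =>
    simp only [traversalCost, Finset.range_zero, Finset.sum_empty, Nat.cast_zero]
    positivity
  | succ t =>
    obtain ⟨h1, h2, h3⟩ := cost_le_pot hw hL t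
    have h4 := pot_le_val (ε := penalty w) (slack_pos hw) rfl h1 h2 w
    have h5 := val_le_pathLen (disc w) h1
    rw [pathLen_code] at h5
    have h6 : (algorithm w (L.upTo t)).length ≤ D :=
      hD.2 ⟨_, ⟨t, _, algorithm_isTraversal w L hL t, List.prefix_refl _⟩, rfl⟩
    have h7 : ((algorithm w (L.upTo t)).length : ℝ) ≤ D := by exact_mod_cast h6
    have h8 : rate w w * traversalCost (algorithm w) L (t + 1) ≤ D :=
      h3.trans (h4.trans (h5.trans h7))
    have h9 := mul_le_mul_of_nonneg_right (one_le_rate hw)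
      (Nat.cast_nonneg (α := ℝ) (traversalCost (algorithm w) L (t + 1)))
    have h10 := mul_le_mul_of_nonneg_left h8
      (show (0 : ℝ) ≤ 162 * (w * 2 ^ w) by positivity)
    linarith

end Traversal

/-! ### Knowledge about the exploration -/

theorem FinTree.mem_of_prefix (T : FinTree) {u v : Node} (h : u <+: v) (hv : v ∈ T.nodes) :
    u ∈ T.nodes := by
  obtain ⟨r, rfl⟩ := h
  induction r using List.reverseRecOn with
  | nil => simpa using hv
  | append_singleton r a ih =>
    apply ih
    have := T.parent_mem _ hv (by simp)
    rwa [← List.append_assoc, List.dropLast_concat] at this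

/-- What a robot knows or what is written on a whiteboard: the nodes to which some robot has moved
down for the first time, and the nodes that have been visited and all of whose children are
opened. The root counts as opened throughout. -/
structure Info where
  opened : Finset Node
  done : Finset Node

namespace Info

/-- Combined knowledge. -/
def union (K K' : Info) : Info := ⟨K.opened ∪ K'.opened, K.done ∪ K'.done⟩

open Classical in
/-- The minimal opened nodes that are not done, as far as known. All work that is left is below
them. -/
noncomputable def layer (K : Info) : Finset Node :=
  (insert [] K.opened).filter fun z => z ∉ K.done ∧ ∀ y, y <+: z → y ≠ z → y ∈ K.done

theorem mem_layer {K : Info} {z : Node} :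
    z ∈ K.layer ↔ (z = [] ∨ z ∈ K.opened) ∧ z ∉ K.done ∧ ∀ y, y <+: z → y ≠ z → y ∈ K.done := by
  simp [layer]

theorem layer_antichain (K : Info) {u v : Node} (hu : u ∈ K.layer) (hv : v ∈ K.layer)
    (h : u <+: v) : u = v := by
  by_contra hne
  exact (mem_layer.1 hu).2.1 ((mem_layer.1 hv).2.2 u h hne)

theorem exists_layer_prefix (T : FinTree) {K : Info}
    (hK : ∀ x ∈ K.done, ∀ v ∈ T.nodes, Node.IsChild v x → v ∈ K.opened) {x : Node}
    (hx : x ∈ T.nodes) (hd : x ∉ K.done) : ∃ y ∈ K.layer, y <+: x := by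
  induction hn : x.length using Nat.strong_induction_on generalizing x with
  | _ n ih =>
    by_cases h : ∀ y, y <+: x → y ≠ x → y ∈ K.done
    · refine ⟨x, mem_layer.2 ⟨?_, hd, h⟩, List.prefix_refl x⟩
      by_cases h0 : x = []
      · exact Or.inl h0
      · refine Or.inr (hK x.dropLast (h _ (List.dropLast_prefix x) fun e => ?_) x hx ⟨h0, rfl⟩)
        have h1 := congrArg List.length e
        have := List.length_pos_of_ne_nil h0
        simp at h1
        omega
    · push Not at h
      obtain ⟨y, hy, hne, hyd⟩ := h
      have hlt : y.length < n := hn ▸ lt_of_le_of_ne hy.length_le fun e => hne (hy.eq_of_length e)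
      obtain ⟨z, hz, hzy⟩ := ih _ hlt (T.mem_of_prefix hy hx) hyd rfl
      exact ⟨z, hz, hzy.trans hy⟩

end Info

/-! ### The exploration algorithm -/

namespace Exploration

/-- Memory of a robot: its knowledge, its position, the node `base` from which its current
excursion started (equal to `pos` if it is not on an excursion), and the layers that it has passed
to the traversal algorithm. -/
structure Memory where
  info : Info
  pos : Node
  base : Node
  layers : List (Finset Node)

open Classical in
/-- Children of `p`, among the adjacent nodes `N`, that are not opened. -/
noncomputable def free (p : Node) (K : Info) (N : Finset Node) : Finset Node :=
  N.filter fun v => Node.IsChild v p ∧ v ∉ K.opened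

open Classical in
/-- Reaction of a robot with memory `m` that reads `b` and sees the neighbors `N`. It goes down to a
child that is not opened if there is one; otherwise it marks its position as done, and returns
towards the base of its excursion. If it is at the base, it passes the current layer to the
traversal algorithm `ℓ` and makes a step towards the node chosen by it. -/
noncomputable def act (ℓ : List (Finset Node) → Node) (m : Memory) (b : Info) (N : Finset Node) :
    Memory :=
  let K := m.info.union b
  if h : (free m.pos K N).Nonempty then
    ⟨⟨insert h.choose K.opened, K.done⟩, h.choose, m.base, m.layers⟩
  else
    let K' : Info := ⟨K.opened, insert m.pos K.done⟩
    if m.pos = m.base then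
      let ls := m.layers ++ [K'.layer]
      ⟨K', Node.stepToward m.pos (ℓ ls), Node.stepToward m.pos (ℓ ls), ls⟩
    else ⟨K', m.pos.dropLast, m.base, m.layers⟩

theorem act_cases (ℓ : List (Finset Node) → Node) (m : Memory) (b : Info) (N : Finset Node) :
    (∃ v ∈ N, Node.IsChild v m.pos ∧ v ∉ (m.info.union b).opened ∧ act ℓ m b N =
      ⟨⟨insert v (m.info.union b).opened, (m.info.union b).done⟩, v, m.base, m.layers⟩) ∨
    ((∀ v ∈ N, Node.IsChild v m.pos → v ∈ (m.info.union b).opened) ∧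
      ∃ K' : Info, K' = ⟨(m.info.union b).opened, insert m.pos (m.info.union b).done⟩ ∧
      ((m.pos = m.base ∧ act ℓ m b N =
          ⟨K', Node.stepToward m.pos (ℓ (m.layers ++ [K'.layer])),
            Node.stepToward m.pos (ℓ (m.layers ++ [K'.layer])), m.layers ++ [K'.layer]⟩) ∨
        (m.pos ≠ m.base ∧ act ℓ m b N = ⟨K', m.pos.dropLast, m.base, m.layers⟩))) := by
  classical
  by_cases h : (free m.pos (m.info.union b) N).Nonempty
  · left
    have h1 := Finset.mem_filter.1 h.choose_spec
    exact ⟨h.choose, h1.1, h1.2.1, h1.2.2, by simp only [act, dif_pos h]⟩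
  · right
    refine ⟨fun v hv hc => ?_, _, rfl, ?_⟩
    · by_contra hn
      exact h ⟨v, Finset.mem_filter.2 ⟨hv, hc, hn⟩⟩
    · by_cases h2 : m.pos = m.base
      · left
        refine ⟨h2, ?_⟩
        simp only [act, dif_neg h]
        rw [if_pos h2]
      · right
        refine ⟨h2, ?_⟩
        simp only [act, dif_neg h]
        rw [if_neg h2]

open Classical in
/-- The exploration algorithm that is guided by the traversal algorithm `ℓ`. -/
noncomputable def explorer (k : ℕ) (ℓ : List (Finset Node) → Node) : DACTEAlgorithm k where
  Mem := Memory
  Board := Info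
  emptyMem := ⟨⟨∅, ∅⟩, [], [], []⟩
  emptyBoard := ⟨∅, ∅⟩
  write _ m b N := (act ℓ m b N).info
  remember _ m b N := act ℓ m b N
  move _ m b N :=
    if (act ℓ m b N).pos ∈ N then (act ℓ m b N).pos
    else if h : N.Nonempty then h.choose else []
  move_mem _ m b N h := by
    split_ifs with h1
    · exact h1
    · exact h.choose_spec

variable {k : ℕ} {ℓ : List (Finset Node) → Node} {T : FinTree}

/-- `K` is the knowledge of some robot or of some whiteboard. -/
def Known (c : (explorer k ℓ).Config) (K : Info) : Prop :=
  (∃ i, K = (c.mem i : Memory).info) ∨ ∃ u, K = c.board u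

/-- The node `v` is opened; this is always known at its parent. -/
def Opened (c : (explorer k ℓ).Config) (v : Node) : Prop :=
  v ∈ (c.board v.dropLast : Info).opened

/-- Two nodes opened by the same robot are comparable, or the first one was done before the second
one was opened, and whoever knows that the latter is opened knows that the former is done; or vice
versa. -/
def Separated (c : (explorer k ℓ).Config) (x x' : Node) : Prop :=
  x <+: x' ∨ x' <+: x ∨ (∀ K, Known c K → x' ∈ K.opened → x ∈ K.done) ∨
    ∀ K, Known c K → x ∈ K.opened → x' ∈ K.done

/-- The node `v` belongs to the current excursion of the robot. -/
def OnExcursion (base pos v : Node) : Prop := base <+: v ∧ base ≠ v ∧ v <+: pos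

/-- Invariants that concern positions and knowledge. The function `owner` gives the robot that
opened the node. -/
structure Sound (T : FinTree) (c : (explorer k ℓ).Config) : Prop where
  pos_eq : ∀ i, (c.mem i : Memory).pos = c.pos i
  pos_mem : ∀ i, c.pos i ∈ T.nodes
  base_prefix : ∀ i, (c.mem i : Memory).base <+: c.pos i
  opened_mem : ∀ K, Known c K → ∀ v ∈ K.opened, v ∈ T.nodes ∧ v ≠ []
  done_children : ∀ K, Known c K → ∀ x ∈ K.done, ∀ v ∈ T.nodes, Node.IsChild v x → v ∈ K.opened
  opened_of_known : ∀ K, Known c K → ∀ v ∈ K.opened, Opened c v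
  exists_owner : ∃ owner : Node → Fin k,
    (∀ v, Opened c v → v ∈ (c.mem (owner v) : Memory).info.done ∨
      OnExcursion (c.mem (owner v) : Memory).base (c.pos (owner v)) v) ∧
    ∀ x x', Opened c x → Opened c x' → owner x = owner x' → Separated c x x'

theorem layer_subset {K : Info} (h : ∀ v ∈ K.opened, v ∈ T.nodes ∧ v ≠ []) :
    K.layer ⊆ T.nodes := by
  intro z hz
  rcases (Info.mem_layer.1 hz).1 with rfl | h1
  · exact T.root_mem
  · exact (h z h1).1

/-- Minimal nodes that are not done have distinct owners, whence there are at most `k` of them. -/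
theorem Sound.card_layer_le {c : (explorer k ℓ).Config} (h : Sound T c) (hk : 1 ≤ k) {K : Info}
    (hK : ∀ v ∈ K.opened, Opened c v)
    (hK' : ∀ x, ∀ x' ∈ K.opened, (∀ K₀, Known c K₀ → x' ∈ K₀.opened → x ∈ K₀.done) → x ∈ K.done) :
    K.layer.card ≤ k := by
  by_cases h0 : [] ∈ K.layer
  · have : K.layer ⊆ {[]} := fun z hz =>
      Finset.mem_singleton.2 (K.layer_antichain h0 hz List.nil_prefix).symm
    exact (Finset.card_le_card this).trans hk
  · obtain ⟨o, _, ho⟩ := h.exists_owner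
    have hop (x : Node) (hx : x ∈ K.layer) : x ∈ K.opened :=
      (Info.mem_layer.1 hx).1.resolve_left fun e => h0 (e ▸ hx)
    have hinj : Set.InjOn o K.layer := by
      intro x hx x' hx' e
      have hd := (Info.mem_layer.1 hx).2.1
      have hd' := (Info.mem_layer.1 hx').2.1
      rcases ho x x' (hK x (hop x hx)) (hK x' (hop x' hx')) e with h1 | h1 | h1 | h1
      · exact K.layer_antichain hx hx' h1
      · exact (K.layer_antichain hx' hx h1).symm
      · exact absurd (hK' x x' (hop x' hx') h1) hd
      · exact absurd (hK' x' x (hop x hx) h1) hd'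
    have := Finset.card_le_card_of_injOn o (t := Finset.univ)
      (fun _ _ => Finset.mem_coe.2 (Finset.mem_univ _)) hinj
    simpa using this

theorem known_mem (c : (explorer k ℓ).Config) (i : Fin k) : Known c (c.mem i : Memory).info :=
  Or.inl ⟨i, rfl⟩

theorem known_board (c : (explorer k ℓ).Config) (u : Node) : Known c (c.board u) :=
  Or.inr ⟨u, rfl⟩

/-- Knowledge of the activated robot after it has read the whiteboard. -/
def merged (c : (explorer k ℓ).Config) (i : Fin k) : Info :=
  (c.mem i : Memory).info.union (c.board (c.pos i))

/-- New memory of the activated robot. -/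
noncomputable def acted (T : FinTree) (c : (explorer k ℓ).Config) (i : Fin k) : Memory :=
  act ℓ (c.mem i) (c.board (c.pos i)) (T.neighbors (c.pos i))

theorem mem_merged_opened {c : (explorer k ℓ).Config} {i : Fin k} {v : Node} :
    v ∈ (merged c i).opened ↔
      v ∈ (c.mem i : Memory).info.opened ∨ v ∈ (c.board (c.pos i) : Info).opened :=
  Finset.mem_union

theorem mem_merged_done {c : (explorer k ℓ).Config} {i : Fin k} {v : Node} :
    v ∈ (merged c i).done ↔
      v ∈ (c.mem i : Memory).info.done ∨ v ∈ (c.board (c.pos i) : Info).done :=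
  Finset.mem_union

theorem known_step {c : (explorer k ℓ).Config} {i : Fin k} {K : Info}
    (h : Known ((explorer k ℓ).step T c i) K) : Known c K ∨ K = (acted T c i).info := by
  rcases h with ⟨j, rfl⟩ | ⟨u, rfl⟩
  · by_cases hj : j = i
    · subst hj
      right
      simp only [DACTEAlgorithm.step, Function.update_self]
      rfl
    · left
      simp only [DACTEAlgorithm.step, Function.update_of_ne hj]
      exact known_mem c j
  · by_cases hu : u = c.pos i
    · subst hu
      right
      simp only [DACTEAlgorithm.step, Function.update_self]
      rfl
    · left
      simp only [DACTEAlgorithm.step, Function.update_of_ne hu]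
      exact known_board c u

theorem step_mem_self (c : (explorer k ℓ).Config) (i : Fin k) :
    ((explorer k ℓ).step T c i).mem i = acted T c i := by
  simp only [DACTEAlgorithm.step, Function.update_self]
  rfl

theorem step_mem_of_ne (c : (explorer k ℓ).Config) {i j : Fin k} (h : j ≠ i) :
    ((explorer k ℓ).step T c i).mem j = c.mem j := by
  simp only [DACTEAlgorithm.step, Function.update_of_ne h]

theorem step_pos_of_ne (c : (explorer k ℓ).Config) {i j : Fin k} (h : j ≠ i) :
    ((explorer k ℓ).step T c i).pos j = c.pos j := by
  simp only [DACTEAlgorithm.step, Function.update_of_ne h]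

theorem step_board_self (c : (explorer k ℓ).Config) (i : Fin k) :
    ((explorer k ℓ).step T c i).board (c.pos i) = (acted T c i).info := by
  simp only [DACTEAlgorithm.step, Function.update_self]
  rfl

theorem step_board_of_ne (c : (explorer k ℓ).Config) {i : Fin k} {u : Node} (h : u ≠ c.pos i) :
    ((explorer k ℓ).step T c i).board u = c.board u := by
  simp only [DACTEAlgorithm.step, Function.update_of_ne h]

theorem step_pos_self (c : (explorer k ℓ).Config) (i : Fin k)
    (h : (acted T c i).pos ∈ T.neighbors (c.pos i)) :
    ((explorer k ℓ).step T c i).pos i = (acted T c i).pos := by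
  simp only [DACTEAlgorithm.step, Function.update_self]
  rw [if_pos ⟨_, h⟩]
  exact if_pos h

/-- What a single activation must respect for the invariants to persist, whichever of the three
kinds of moves it makes. -/
structure GoodAct (T : FinTree) (c : (explorer k ℓ).Config) (i : Fin k) : Prop where
  pos_mem : (acted T c i).pos ∈ T.neighbors (c.pos i)
  base_prefix : (acted T c i).base <+: (acted T c i).pos
  opened_mono : (merged c i).opened ⊆ (acted T c i).info.opened
  done_mono : (merged c i).done ⊆ (acted T c i).info.done
  opened_new : ∀ v ∈ (acted T c i).info.opened, v ∈ (merged c i).opened ∨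
    (v ∈ T.nodes ∧ Node.IsChild v (c.pos i) ∧ v ∉ (merged c i).opened ∧ v = (acted T c i).pos ∧
      (acted T c i).base = (c.mem i : Memory).base)
  done_new : ∀ x ∈ (acted T c i).info.done, x ∈ (merged c i).done ∨
    (x = c.pos i ∧ ∀ v ∈ T.nodes, Node.IsChild v x → v ∈ (acted T c i).info.opened)
  excursion : ∀ v, OnExcursion (c.mem i : Memory).base (c.pos i) v →
    v ∈ (acted T c i).info.done ∨ OnExcursion (acted T c i).base (acted T c i).pos v

theorem isChild_prefix {v u : Node} (h : Node.IsChild v u) : u <+: v :=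
  h.2 ▸ List.dropLast_prefix v

theorem isChild_ne {v u : Node} (h : Node.IsChild v u) : u ≠ v := by
  intro e
  have h1 := congrArg List.length h.2
  have h2 := List.length_pos_of_ne_nil h.1
  rw [e] at h1
  simp at h1
  omega

theorem GoodAct.opened_step_iff {c : (explorer k ℓ).Config} {i : Fin k} (h : Sound T c)
    (ha : GoodAct T c i) (v : Node) : Opened ((explorer k ℓ).step T c i) v ↔
      Opened c v ∨ v ∈ (acted T c i).info.opened := by
  have key : v ∈ (merged c i).opened → Opened c v := fun hv =>
    (mem_merged_opened.1 hv).elim (h.opened_of_known _ (known_mem c i) v)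
      (h.opened_of_known _ (known_board c _) v)
  unfold Opened
  by_cases hv : v.dropLast = c.pos i
  · rw [hv, step_board_self]
    refine ⟨Or.inr, fun h1 => h1.elim (fun h2 => ?_) id⟩
    exact ha.opened_mono (mem_merged_opened.2 (Or.inr h2))
  · rw [step_board_of_ne c hv]
    refine ⟨Or.inl, fun h1 => h1.elim id fun h2 => ?_⟩
    rcases ha.opened_new v h2 with h3 | h3
    · exact key h3
    · exact absurd h3.2.1.2 hv

theorem Sound.step {c : (explorer k ℓ).Config} {i : Fin k} (h : Sound T c)
    (ha : GoodAct T c i) : Sound T ((explorer k ℓ).step T c i) := by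
  have hpos := step_pos_self c i ha.pos_mem
  have hN : (acted T c i).pos ∈ T.nodes := (Finset.mem_filter.1 ha.pos_mem).1
  have hkm := known_mem c i
  have hkb := known_board c (c.pos i)
  refine ⟨fun j => ?_, fun j => ?_, fun j => ?_, fun K hK v hv => ?_, fun K hK x hx v hv hc => ?_,
    fun K hK v hv => ?_, ?_⟩
  · by_cases hj : j = i
    · subst hj
      rw [hpos, step_mem_self]
    · rw [step_mem_of_ne c hj, step_pos_of_ne c hj]
      exact h.pos_eq j
  · by_cases hj : j = i
    · subst hj
      rwa [hpos]
    · rw [step_pos_of_ne c hj]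
      exact h.pos_mem j
  · by_cases hj : j = i
    · subst hj
      rw [hpos, step_mem_self]
      exact ha.base_prefix
    · rw [step_mem_of_ne c hj, step_pos_of_ne c hj]
      exact h.base_prefix j
  · rcases known_step hK with hK' | rfl
    · exact h.opened_mem K hK' v hv
    · rcases ha.opened_new v hv with h1 | h1
      · exact (mem_merged_opened.1 h1).elim (h.opened_mem _ hkm v) (h.opened_mem _ hkb v)
      · exact ⟨h1.1, h1.2.1.1⟩
  · rcases known_step hK with hK' | rfl
    · exact h.done_children K hK' x hx v hv hc
    · rcases ha.done_new x hx with h1 | h1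
      · refine ha.opened_mono (mem_merged_opened.2 ?_)
        exact (mem_merged_done.1 h1).imp (fun h2 => h.done_children _ hkm x h2 v hv hc)
          (fun h2 => h.done_children _ hkb x h2 v hv hc)
      · exact h1.2 v hv hc
  · rw [ha.opened_step_iff h]
    rcases known_step hK with hK' | rfl
    · exact Or.inl (h.opened_of_known K hK' v hv)
    · exact Or.inr hv
  · classical
    obtain ⟨o, ho1, ho2⟩ := h.exists_owner
    have hold {v : Node} (hv : Opened ((explorer k ℓ).step T c i) v) (hn : ¬ Opened c v) :
        v = (acted T c i).pos ∧ Node.IsChild v (c.pos i) ∧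
          (acted T c i).base = (c.mem i : Memory).base ∧
          ∀ K, Known ((explorer k ℓ).step T c i) K → v ∈ K.opened → K = (acted T c i).info := by
      have h1 := ((ha.opened_step_iff h v).1 hv).resolve_left hn
      rcases ha.opened_new v h1 with h2 | h2
      · exact absurd ((mem_merged_opened.1 h2).elim (h.opened_of_known _ hkm v)
          (h.opened_of_known _ hkb v)) hn
      · refine ⟨h2.2.2.2.1, h2.2.1, h2.2.2.2.2, fun K hK hvK => ?_⟩
        rcases known_step hK with hK' | rfl
        · exact absurd (h.opened_of_known K hK' v hvK) hn
        · rfl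
    -- A pair of a node opened earlier by the active robot and the node that it opens now.
    have hnew {x v : Node} (hx : Opened c x) (hox : o x = i)
        (hv : Opened ((explorer k ℓ).step T c i) v) (hn : ¬ Opened c v) :
        x <+: v ∨ ∀ K, Known ((explorer k ℓ).step T c i) K → v ∈ K.opened → x ∈ K.done := by
      obtain ⟨_, h2, _, h3⟩ := hold hv hn
      rcases ho1 x hx with h4 | h4
      · right
        intro K hK hvK
        rw [h3 K hK hvK]
        rw [hox] at h4
        exact ha.done_mono (mem_merged_done.2 (Or.inl h4))
      · left
        rw [hox] at h4
        exact h4.2.2.trans (isChild_prefix h2)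
    have hsep {x x' : Node} (hx' : Opened c x')
        (hs : ∀ K, Known c K → x' ∈ K.opened → x ∈ K.done) :
        ∀ K, Known ((explorer k ℓ).step T c i) K → x' ∈ K.opened → x ∈ K.done := by
      intro K hK hxK
      rcases known_step hK with hK' | rfl
      · exact hs K hK' hxK
      · rcases ha.opened_new x' hxK with h1 | h1
        · exact ha.done_mono (mem_merged_done.2
            ((mem_merged_opened.1 h1).imp (hs _ hkm) (hs _ hkb)))
        · refine absurd (mem_merged_opened.2 (Or.inr ?_)) h1.2.2.1
          have := hx'
          unfold Opened at this
          rwa [h1.2.1.2] at this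
    obtain ⟨o', ho, hi'⟩ : ∃ o' : Node → Fin k,
        (∀ v, Opened c v → o' v = o v) ∧ ∀ v, ¬ Opened c v → o' v = i :=
      ⟨fun v => if Opened c v then o v else i, fun v hv => if_pos hv, fun v hv => if_neg hv⟩
    refine ⟨o', fun v hv => ?_, fun x x' hx hx' e => ?_⟩
    · by_cases hvc : Opened c v
      · rw [ho v hvc]
        have h1 := ho1 v hvc
        by_cases hi : o v = i
        · rw [hi] at h1 ⊢
          rw [hpos, step_mem_self]
          rcases h1 with h1 | h1
          · exact Or.inl (ha.done_mono (mem_merged_done.2 (Or.inl h1)))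
          · exact ha.excursion v h1
        · rwa [step_mem_of_ne c hi, step_pos_of_ne c hi]
      · rw [hi' v hvc, hpos, step_mem_self]
        obtain ⟨h1, h2, h3, _⟩ := hold hv hvc
        right
        have h4 := h.base_prefix i
        refine ⟨h3 ▸ h4.trans (isChild_prefix h2), fun e => ?_, h1 ▸ List.prefix_refl _⟩
        rw [h3] at e
        rw [e] at h4
        exact isChild_ne h2 ((isChild_prefix h2).eq_of_length
          (le_antisymm (isChild_prefix h2).length_le h4.length_le))
    · by_cases hxc : Opened c x
      · by_cases hxc' : Opened c x'
        · rw [ho x hxc, ho x' hxc'] at e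
          rcases ho2 x x' hxc hxc' e with h1 | h1 | h1 | h1
          · exact Or.inl h1
          · exact Or.inr (Or.inl h1)
          · exact Or.inr (Or.inr (Or.inl (hsep hxc' h1)))
          · exact Or.inr (Or.inr (Or.inr (hsep hxc h1)))
        · rw [ho x hxc, hi' x' hxc'] at e
          rcases hnew hxc e hx' hxc' with h1 | h1
          · exact Or.inl h1
          · exact Or.inr (Or.inr (Or.inl h1))
      · by_cases hxc' : Opened c x'
        · rw [hi' x hxc, ho x' hxc'] at e
          rcases hnew hxc' e.symm hx hxc with h1 | h1
          · exact Or.inr (Or.inl h1)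
          · exact Or.inr (Or.inr (Or.inr h1))
        · rw [(hold hx hxc).1, (hold hx' hxc').1]
          exact Or.inl (List.prefix_refl _)

/-! ### The layers seen by a robot -/

theorem upTo_congr {L L' : LayeredTree} {t : ℕ} (h : ∀ j ≤ t, L.layer j = L'.layer j) :
    L.upTo t = L'.upTo t := by
  unfold LayeredTree.upTo
  refine List.map_congr_left fun j hj => h j ?_
  have := List.mem_range.1 hj
  omega

theorem traversalCost_congr {L L' : LayeredTree} {t : ℕ} (h : ∀ j < t, L.layer j = L'.layer j) :
    traversalCost ℓ L t = traversalCost ℓ L' t := by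
  unfold traversalCost
  refine Finset.sum_congr rfl fun s hs => ?_
  have hs' := Finset.mem_range.1 hs
  rw [upTo_congr (L := L) (L' := L') (t := s) fun j hj => h j (by omega),
    upTo_congr (L := L) (L' := L') (t := s - 1) fun j hj => h j (by omega)]

/-- The layers in the memory `m` begin a layered tree inside `T` of width at most `k`. All nodes
that are not known to be done are below each of these layers, and the moves that the robot made
outside of excursions are paid for by the moves of the traversal algorithm. -/
def Tracked (T : FinTree) (k : ℕ) (ℓ : List (Finset Node) → Node) (m : Memory) : Prop :=
  ∃ L : LayeredTree, L.WidthLE k ∧ (∀ j, L.layer j ⊆ T.nodes) ∧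
    m.layers = (List.range m.layers.length).map L.layer ∧
    (∀ x ∈ T.nodes, x ∉ m.info.done → ∀ j < m.layers.length, ∃ y ∈ L.layer j, y <+: x) ∧
    m.layers.length +
      Node.dist m.base (if m.layers.length = 0 then [] else ℓ (L.upTo (m.layers.length - 1))) ≤
      traversalCost ℓ L m.layers.length

theorem Tracked.mono {m m' : Memory} (h : Tracked T k ℓ m) (hl : m'.layers = m.layers)
    (hb : m'.base = m.base) (hd : m.info.done ⊆ m'.info.done) : Tracked T k ℓ m' := by
  obtain ⟨L, h1, h2, h3, h4, h5⟩ := h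
  refine ⟨L, h1, h2, ?_, ?_, ?_⟩
  · rwa [hl]
  · rw [hl]
    exact fun x hx hxd => h4 x hx fun h' => hxd (hd h')
  · rwa [hl, hb]

/-- The layered tree whose layers are those of `L` before time `n` and `S` from then on. -/
def extend (L : LayeredTree) (n : ℕ) (S : Finset Node) (hne : S.Nonempty)
    (hS : ∀ u ∈ S, ∀ v ∈ S, u <+: v → u = v)
    (hL : ∀ j < n, ∀ v ∈ S, ∃ u ∈ L.layer j, u <+: v) : LayeredTree where
  layer j := if j < n then L.layer j else S
  nonempty j := by
    split_ifs
    · exact L.nonempty j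
    · exact hne
  antichain j := by
    split_ifs
    · exact L.antichain j
    · exact hS
  descends j v hv := by
    by_cases h1 : j + 1 < n
    · rw [if_pos h1] at hv
      rw [if_pos (by omega)]
      exact L.descends j v hv
    · rw [if_neg h1] at hv
      by_cases h2 : j < n
      · rw [if_pos h2]
        exact hL j h2 v hv
      · rw [if_neg h2]
        exact ⟨v, hv, List.prefix_refl v⟩

theorem Tracked.append {m : Memory} (h : Tracked T k ℓ m) (hℓ : IsTraversal k ℓ) {K : Info}
    (hd : m.info.done ⊆ K.done)
    (hK : ∀ x ∈ K.done, ∀ v ∈ T.nodes, Node.IsChild v x → v ∈ K.opened)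
    (hop : ∀ v ∈ K.opened, v ∈ T.nodes ∧ v ≠ []) (hcard : K.layer.card ≤ k)
    (hne : K.layer.Nonempty) (hmb : m.base ∈ K.done) :
    ℓ (m.layers ++ [K.layer]) ∈ K.layer ∧
    ∀ m' : Memory, m'.info = K → m'.base = Node.stepToward m.base (ℓ (m.layers ++ [K.layer])) →
      m'.layers = m.layers ++ [K.layer] → Tracked T k ℓ m' := by
  obtain ⟨L, h1, h2, h3, h4, h5⟩ := h
  set n := m.layers.length with hn
  have hsub := layer_subset hop
  have hnd (v : Node) (hv : v ∈ K.layer) : v ∉ m.info.done := fun h' =>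
    (Info.mem_layer.1 hv).2.1 (hd h')
  set L' := extend L n K.layer hne (fun u hu v hv huv => K.layer_antichain hu hv huv)
    (fun j hj v hv => h4 v (hsub hv) (hnd v hv) j hj) with hL'
  have hlt {j : ℕ} (hj : j < n) : L.layer j = L'.layer j := by
    simp [hL', extend, hj]
  have hge {j : ℕ} (hj : ¬ j < n) : L'.layer j = K.layer := by
    simp [hL', extend, hj]
  have hw : L'.WidthLE k := fun j => by
    by_cases hj : j < n
    · rw [← hlt hj]
      exact h1 j
    · rwa [hge hj]
  have hup : m.layers ++ [K.layer] = L'.upTo n := by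
    rw [LayeredTree.upTo, List.range_succ, List.map_append, h3]
    congr 1
    · refine List.map_congr_left fun j hj => hlt (List.mem_range.1 hj)
    · simp [hge]
  have hmem : ℓ (m.layers ++ [K.layer]) ∈ K.layer := by
    rw [hup, ← hge (lt_irrefl n)]
    exact hℓ L' hw n
  refine ⟨hmem, fun m' hi hb hl => ?_⟩
  have hlen : m'.layers.length = n + 1 := by simp [hl, hn]
  refine ⟨L', hw, fun j => ?_, ?_, ?_, ?_⟩
  · by_cases hj : j < n
    · rw [← hlt hj]
      exact h2 j
    · rwa [hge hj]
  · rw [hlen, hl, hup]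
    rfl
  · intro x hx hxd j hj
    rw [hi] at hxd
    by_cases hjn : j < n
    · rw [← hlt hjn]
      exact h4 x hx (fun h' => hxd (hd h')) j hjn
    · rw [hge hjn]
      exact Info.exists_layer_prefix T hK hx hxd
  · have hne' : m.base ≠ ℓ (m.layers ++ [K.layer]) := fun e =>
      (Info.mem_layer.1 hmem).2.1 (e ▸ hmb)
    have hstep := Node.dist_stepToward hne'
    have hprev : (if n = 0 then [] else ℓ (L.upTo (n - 1))) =
        (if n = 0 then [] else ℓ (L'.upTo (n - 1))) := by
      split_ifs with h0
      · rfl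
      · rw [upTo_congr fun j hj => hlt (by omega)]
    rw [hlen, hb, Traversal.traversalCost_succ, if_neg (Nat.succ_ne_zero n), Nat.add_sub_cancel,
      ← hup, ← hprev, ← traversalCost_congr fun j hj => hlt hj]
    have := Node.dist_triangle m.base (if n = 0 then [] else ℓ (L.upTo (n - 1)))
      (ℓ (m.layers ++ [K.layer]))
    omega

theorem nonneg_of_isCompetitive {c : ℝ} (hk : 1 ≤ k) (h : IsCompetitive k c ℓ) : 0 ≤ c := by
  let L : LayeredTree := ⟨fun _ => {[0]}, fun _ => ⟨[0], by simp⟩,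
    fun _ u hu v hv _ => by rw [Finset.mem_singleton.1 hu, Finset.mem_singleton.1 hv],
    fun _ v hv => ⟨v, hv, List.prefix_refl v⟩⟩
  have hL : L.HasDepth 1 := by
    refine ⟨⟨[0], ⟨0, [0], by simp [L], List.prefix_refl _⟩, rfl⟩, ?_⟩
    rintro _ ⟨u, ⟨t, v, hv, huv⟩, rfl⟩
    have e : v = [0] := by simpa [L] using hv
    have := huv.length_le
    simpa [e] using this
  have := h.2 L 1 (fun t => by simpa [L] using hk) hL 0
  simpa [traversalCost] using this

theorem Tracked.length_le {c : ℝ} (hk : 1 ≤ k) (h : IsCompetitive k c ℓ) {m : Memory}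
    (hm : Tracked T k ℓ m) : (m.layers.length : ℝ) ≤ c * T.depth := by
  obtain ⟨L, h1, h2, -, -, h5⟩ := hm
  have hsub : L.underlying ⊆ T.nodes := by
    rintro u ⟨t, v, hv, huv⟩
    exact T.mem_of_prefix huv (h2 t hv)
  have hfin : (List.length '' L.underlying).Finite :=
    (T.nodes.finite_toSet.subset hsub).image _
  obtain ⟨v, hv⟩ := L.nonempty 0
  have hne : (List.length '' L.underlying).Nonempty :=
    ⟨_, v, ⟨0, v, hv, List.prefix_refl v⟩, rfl⟩
  obtain ⟨D, hD⟩ := hfin.exists_maximal hne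
  have hD' : L.HasDepth D := ⟨hD.1, fun x hx => (le_total x D).elim id fun h' => hD.2 hx h'⟩
  obtain ⟨u, hu, huD⟩ := hD.1
  have hle : D ≤ T.depth := huD ▸ Finset.le_sup (f := List.length) (hsub hu)
  have h6 := h.2 L D h1 hD' m.layers.length
  have h7 : (m.layers.length : ℝ) ≤ traversalCost ℓ L m.layers.length := by
    exact_mod_cast (Nat.le_add_right _ _).trans h5
  have h8 : (D : ℝ) ≤ T.depth := by exact_mod_cast hle
  exact h7.trans (h6.trans (mul_le_mul_of_nonneg_left h8 (nonneg_of_isCompetitive hk h)))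

/-! ### Counting moves -/

/-- Contribution of a robot to the count of moves: the number of moves outside of excursions less
the depth of the current excursion. -/
def credit (m : Memory) : ℤ := m.layers.length - (m.pos.length - m.base.length)

open Classical in
/-- The opened nodes. -/
noncomputable def openedNodes (T : FinTree) (c : (explorer k ℓ).Config) : Finset Node :=
  T.nodes.filter (Opened c)

theorem mem_neighbors {u v : Node} :
    v ∈ T.neighbors u ↔ v ∈ T.nodes ∧ (Node.IsChild v u ∨ Node.IsChild u v) :=
  Finset.mem_filter

theorem dropLast_mem_neighbors {u : Node} (hu : u ∈ T.nodes) (h : u ≠ []) :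
    u.dropLast ∈ T.neighbors u :=
  mem_neighbors.2 ⟨T.parent_mem u hu h, Or.inr ⟨h, rfl⟩⟩

theorem stepToward_mem_neighbors {u v : Node} (hu : u ∈ T.nodes) (hv : v ∈ T.nodes) (h : u ≠ v) :
    Node.stepToward u v ∈ T.neighbors u := by
  by_cases hp : u <+: v
  · have := Node.stepToward_of_prefix hp h
    exact mem_neighbors.2 ⟨T.mem_of_prefix this.2 hv, Or.inl this.1⟩
  · rw [Node.stepToward, if_neg hp]
    exact dropLast_mem_neighbors hu (Node.ne_nil_of_not_prefix hp)

theorem Sound.opened_of_mem_merged {c : (explorer k ℓ).Config} (h : Sound T c) {i : Fin k}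
    {v : Node} (hv : v ∈ (merged c i).opened) : Opened c v :=
  (mem_merged_opened.1 hv).elim (h.opened_of_known _ (known_mem c i) v)
    (h.opened_of_known _ (known_board c _) v)

theorem Sound.mem_of_mem_merged {c : (explorer k ℓ).Config} (h : Sound T c) {i : Fin k}
    {v : Node} (hv : v ∈ (merged c i).opened) : v ∈ T.nodes ∧ v ≠ [] :=
  (mem_merged_opened.1 hv).elim (h.opened_mem _ (known_mem c i) v)
    (h.opened_mem _ (known_board c _) v)

/-- The effect of an activation, as long as some node is not known to be done: the invariants
persist and the count of moves increases by one. -/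
theorem Sound.activate {c : (explorer k ℓ).Config} (h : Sound T c) (hk : 1 ≤ k)
    (hℓ : IsTraversal k ℓ) (i : Fin k) (ht : Tracked T k ℓ (c.mem i))
    (hrem : ∃ u ∈ T.nodes, u ≠ c.pos i ∧ u ∉ (merged c i).done) :
    GoodAct T c i ∧ Tracked T k ℓ (acted T c i) ∧
      2 * ((openedNodes T ((explorer k ℓ).step T c i)).card : ℤ) + credit (acted T c i) =
        2 * ((openedNodes T c).card : ℤ) + credit (c.mem i) + 1 := by
  classical
  have hp := h.pos_eq i
  have hpT := h.pos_mem i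
  have hbase := h.base_prefix i
  have hcases := act_cases ℓ (c.mem i) (c.board (c.pos i)) (T.neighbors (c.pos i))
  rw [hp] at hcases
  change (∃ v ∈ T.neighbors (c.pos i), Node.IsChild v (c.pos i) ∧ v ∉ (merged c i).opened ∧
      acted T c i = ⟨⟨insert v (merged c i).opened, (merged c i).done⟩, v,
        (c.mem i : Memory).base, (c.mem i : Memory).layers⟩) ∨
    ((∀ v ∈ T.neighbors (c.pos i), Node.IsChild v (c.pos i) → v ∈ (merged c i).opened) ∧
      ∃ K' : Info, K' = ⟨(merged c i).opened, insert (c.pos i) (merged c i).done⟩ ∧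
      ((c.pos i = (c.mem i : Memory).base ∧ acted T c i =
          ⟨K', Node.stepToward (c.pos i) (ℓ ((c.mem i : Memory).layers ++ [K'.layer])),
            Node.stepToward (c.pos i) (ℓ ((c.mem i : Memory).layers ++ [K'.layer])),
            (c.mem i : Memory).layers ++ [K'.layer]⟩) ∨
        (c.pos i ≠ (c.mem i : Memory).base ∧ acted T c i =
          ⟨K', (c.pos i).dropLast, (c.mem i : Memory).base, (c.mem i : Memory).layers⟩)))
    at hcases
  have hdone_sub : (c.mem i : Memory).info.done ⊆ (merged c i).done := fun x hx =>
    mem_merged_done.2 (Or.inl hx)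
  rcases hcases with ⟨v, hvN, hvc, hvo, hact⟩ | ⟨hall, K', hK', hact⟩
  · -- The robot goes down to the new node `v`.
    have hvT := (mem_neighbors.1 hvN).1
    have hga : GoodAct T c i := by
      constructor <;> rw [hact]
      · exact hvN
      · exact hbase.trans (isChild_prefix hvc)
      · exact Finset.subset_insert _ _
      · intro w hw
        rcases Finset.mem_insert.1 hw with rfl | hw
        · exact Or.inr ⟨hvT, hvc, hvo, rfl, rfl⟩
        · exact Or.inl hw
      · exact fun x hx => Or.inl hx
      · exact fun w hw => Or.inr ⟨hw.1, hw.2.1, hw.2.2.trans (isChild_prefix hvc)⟩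
    refine ⟨hga, ht.mono (by rw [hact]) (by rw [hact]) (by rw [hact]; exact hdone_sub), ?_⟩
    have hnv : ¬ Opened c v := fun h' => by
      unfold Opened at h'
      rw [hvc.2] at h'
      exact hvo (mem_merged_opened.2 (Or.inr h'))
    have e : openedNodes T ((explorer k ℓ).step T c i) = insert v (openedNodes T c) := by
      ext w
      simp only [openedNodes, Finset.mem_filter, Finset.mem_insert, hga.opened_step_iff h]
      rw [hact]
      constructor
      · rintro ⟨hw, h1 | h1⟩
        · exact Or.inr ⟨hw, h1⟩
        · rcases Finset.mem_insert.1 h1 with rfl | h1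
          · exact Or.inl rfl
          · exact Or.inr ⟨hw, h.opened_of_mem_merged h1⟩
      · rintro (rfl | ⟨hw, h1⟩)
        · exact ⟨hvT, Or.inr (Finset.mem_insert_self _ _)⟩
        · exact ⟨hw, Or.inl h1⟩
    have hlen : v.length = (c.pos i).length + 1 := by
      have h1 := congrArg List.length hvc.2
      have := List.length_pos_of_ne_nil hvc.1
      simp at h1
      omega
    have hcard : (openedNodes T ((explorer k ℓ).step T c i)).card = (openedNodes T c).card + 1 := by
      rw [e, Finset.card_insert_of_notMem]
      exact fun h' => hnv (Finset.mem_filter.1 h').2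
    rw [hcard, hact]
    simp only [credit, hp, hlen]
    push_cast
    ring
  · have hKd : (merged c i).done ⊆ K'.done := by
      rw [hK']
      exact Finset.subset_insert _ _
    have hKo : K'.opened = (merged c i).opened := by rw [hK']
    have hpd : c.pos i ∈ K'.done := by
      rw [hK']
      exact Finset.mem_insert_self _ _
    have hchild : ∀ v ∈ T.nodes, Node.IsChild v (c.pos i) → v ∈ K'.opened := fun v hv hvc => by
      rw [hKo]
      exact hall v (mem_neighbors.2 ⟨hv, Or.inl hvc⟩) hvc
    have hdn : ∀ x ∈ K'.done, x ∈ (merged c i).done ∨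
        (x = c.pos i ∧ ∀ v ∈ T.nodes, Node.IsChild v x → v ∈ K'.opened) := fun x hx => by
      rw [hK'] at hx
      rcases Finset.mem_insert.1 hx with rfl | hx
      · exact Or.inr ⟨rfl, hchild⟩
      · exact Or.inl hx
    -- Without a new node, the set of opened nodes does not change.
    have hsame (hga : GoodAct T c i) (hai : (acted T c i).info = K') :
        openedNodes T ((explorer k ℓ).step T c i) = openedNodes T c := by
      ext w
      simp only [openedNodes, Finset.mem_filter, hga.opened_step_iff h]
      rw [hai, hKo]
      exact and_congr_right fun _ => ⟨fun h' => h'.elim id h.opened_of_mem_merged, Or.inl⟩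
    rcases hact with ⟨hpb, hact⟩ | ⟨hpb, hact⟩
    · -- The robot makes a step towards the node chosen by the traversal algorithm.
      have hdc : ∀ x ∈ K'.done, ∀ v ∈ T.nodes, Node.IsChild v x → v ∈ K'.opened := by
        intro x hx v hv hvc
        rcases hdn x hx with h1 | h1
        · rw [hKo, mem_merged_opened]
          exact (mem_merged_done.1 h1).imp
            (fun h2 => h.done_children _ (known_mem c i) x h2 v hv hvc)
            (fun h2 => h.done_children _ (known_board c _) x h2 v hv hvc)
        · exact h1.2 v hv hvc
      have hop : ∀ v ∈ K'.opened, v ∈ T.nodes ∧ v ≠ [] := fun v hv =>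
        h.mem_of_mem_merged (hKo ▸ hv)
      have hcard : K'.layer.card ≤ k := by
        refine h.card_layer_le hk (fun v hv => h.opened_of_mem_merged (hKo ▸ hv))
          fun x x' hx' hx => hKd (mem_merged_done.2 ?_)
        rw [hKo, mem_merged_opened] at hx'
        exact hx'.imp (hx _ (known_mem c i)) (hx _ (known_board c _))
      have hne : K'.layer.Nonempty := by
        obtain ⟨u, hu, hup, hud⟩ := hrem
        have : u ∉ K'.done := fun h' => (hdn u h').elim hud fun h2 => hup h2.1
        obtain ⟨y, hy, _⟩ := Info.exists_layer_prefix T hdc hu this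
        exact ⟨y, hy⟩
      obtain ⟨hmem, htr⟩ := ht.append hℓ (hdone_sub.trans hKd) hdc hop hcard hne (hpb ▸ hpd)
      have hga : GoodAct T c i := by
        constructor <;> rw [hact]
        · refine stepToward_mem_neighbors hpT (layer_subset hop hmem) fun e => ?_
          exact (Info.mem_layer.1 hmem).2.1 (e ▸ hpd)
        · exact hKo.ge
        · exact hKd
        · exact fun v hv => Or.inl (hKo ▸ hv)
        · exact hdn
        · intro v hv
          refine absurd ?_ hv.2.1
          rw [← hpb]
          exact (hpb ▸ hv.1).eq_of_length (le_antisymm (hpb ▸ hv.1).length_le hv.2.2.length_le)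
      refine ⟨hga, htr _ (by rw [hact]) (by rw [hact, ← hpb]) (by rw [hact]), ?_⟩
      rw [hsame hga (by rw [hact]), hact]
      simp only [credit, hp, ← hpb, List.length_append, List.length_singleton]
      push_cast
      ring
    · -- The robot goes up, towards the base of its excursion.
      have hp0 : c.pos i ≠ [] := fun e => hpb (by
        rw [e] at hbase ⊢
        exact (List.prefix_nil.1 hbase).symm)
      have hlen : ((c.pos i).dropLast).length + 1 = (c.pos i).length := by
        have := List.length_pos_of_ne_nil hp0
        simp
        omega
      have hup {v : Node} (hv : v <+: c.pos i) (hne : v ≠ c.pos i) : v <+: (c.pos i).dropLast := by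
        refine List.prefix_of_prefix_length_le hv (List.dropLast_prefix _) ?_
        have := lt_of_le_of_ne hv.length_le fun e => hne (hv.eq_of_length e)
        omega
      have hga : GoodAct T c i := by
        constructor <;> rw [hact]
        · exact dropLast_mem_neighbors hpT hp0
        · exact hup hbase (Ne.symm hpb)
        · exact hKo.ge
        · exact hKd
        · exact fun v hv => Or.inl (hKo ▸ hv)
        · exact hdn
        · intro v hv
          by_cases hvp : v = c.pos i
          · exact Or.inl (hvp ▸ hpd)
          · exact Or.inr ⟨hv.1, hv.2.1, hup hv.2.2 hvp⟩
      refine ⟨hga, ht.mono (by rw [hact]) (by rw [hact])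
        (by rw [hact]; exact hdone_sub.trans hKd), ?_⟩
      rw [hsame hga (by rw [hact]), hact]
      simp only [credit, hp, ← hlen]
      push_cast
      ring

/-- The invariants of a run. -/
structure Invariant (T : FinTree) (s : ℕ → Fin k) (t : ℕ) (c : (explorer k ℓ).Config) : Prop where
  sound : Sound T c
  visited : ∀ K, Known c K → ∀ x ∈ K.done, (explorer k ℓ).Visited T s t x
  tracked : ∀ i, Tracked T k ℓ (c.mem i)
  count : (t : ℤ) = 2 * ((openedNodes T c).card : ℤ) + ∑ i, credit (c.mem i)

theorem invariant_initial (hk : 1 ≤ k) (T : FinTree) (s : ℕ → Fin k) :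
    Invariant T s 0 (explorer k ℓ).initial := by
  have hm (i : Fin k) : (explorer k ℓ).initial.mem i = (⟨⟨∅, ∅⟩, [], [], []⟩ : Memory) := rfl
  have hK (K : Info) (h : Known (explorer k ℓ).initial K) : K = ⟨∅, ∅⟩ := by
    rcases h with ⟨i, rfl⟩ | ⟨u, rfl⟩ <;> rfl
  have ho (v : Node) : ¬ Opened (explorer k ℓ).initial v := fun h => by
    unfold Opened at h
    rw [hK _ (known_board _ _)] at h
    simp at h
  refine ⟨⟨fun i => rfl, fun i => T.root_mem, fun i => List.prefix_refl _, ?_, ?_, ?_, ?_⟩, ?_, ?_,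
    ?_⟩
  · intro K h v hv
    rw [hK K h] at hv
    simp at hv
  · intro K h v hv
    rw [hK K h] at hv
    simp at hv
  · intro K h v hv
    rw [hK K h] at hv
    simp at hv
  · exact ⟨fun _ => ⟨0, hk⟩, fun v hv => absurd hv (ho v), fun x x' hx => absurd hx (ho x)⟩
  · intro K h v hv
    rw [hK K h] at hv
    simp at hv
  · intro i
    rw [hm]
    let L : LayeredTree := ⟨fun _ => {[]}, fun _ => ⟨[], by simp⟩,
      fun _ u hu v hv _ => by rw [Finset.mem_singleton.1 hu, Finset.mem_singleton.1 hv],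
      fun _ v hv => ⟨v, hv, List.prefix_refl v⟩⟩
    refine ⟨L, fun t => by simpa [L] using hk, fun t => by simpa [L] using T.root_mem, by simp,
      by simp, ?_⟩
    simp [Node.dist_self]
  · classical
    have : openedNodes T (explorer k ℓ).initial = ∅ :=
      Finset.filter_eq_empty_iff.2 fun v _ => ho v
    rw [this]
    simp [hm, credit]

theorem visited_succ {A : DACTEAlgorithm k} {s : ℕ → Fin k} {t : ℕ} {u : Node}
    (h : A.Visited T s t u) : A.Visited T s (t + 1) u := by
  obtain ⟨r, hr, h⟩ := h
  exact ⟨r, by omega, h⟩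

theorem invariant_run (hk : 1 ≤ k) (hℓ : IsTraversal k ℓ) (T : FinTree) (s : ℕ → Fin k) (t : ℕ)
    (h : ∃ u ∈ T.nodes, ¬ (explorer k ℓ).Visited T s t u) :
    Invariant T s t ((explorer k ℓ).run T s t) := by
  induction t with
  | zero => exact invariant_initial hk T s
  | succ t ih =>
    obtain ⟨u, hu, hnu⟩ := h
    have hinv := ih ⟨u, hu, fun h' => hnu (visited_succ h')⟩
    set c := (explorer k ℓ).run T s t with hc
    set i := s t with hi
    have hvp : (explorer k ℓ).Visited T s (t + 1) (c.pos i) := ⟨t, by omega, rfl⟩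
    have hvm (x : Node) (hx : x ∈ (merged c i).done) : (explorer k ℓ).Visited T s (t + 1) x :=
      visited_succ ((mem_merged_done.1 hx).elim (hinv.visited _ (known_mem c i) x)
        (hinv.visited _ (known_board c _) x))
    obtain ⟨hga, htr, hcount⟩ := hinv.sound.activate hk hℓ i (hinv.tracked i)
      ⟨u, hu, fun e => hnu (e ▸ hvp), fun h' => hnu (hvm u h')⟩
    change Invariant T s (t + 1) ((explorer k ℓ).step T c i)
    refine ⟨hinv.sound.step hga, fun K hK x hx => ?_, fun j => ?_, ?_⟩
    · rcases known_step hK with hK' | rfl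
      · exact visited_succ (hinv.visited K hK' x hx)
      · rcases hga.done_new x hx with h1 | h1
        · exact hvm x h1
        · exact h1.1 ▸ hvp
    · by_cases hj : j = i
      · rw [hj, step_mem_self]
        exact htr
      · rw [step_mem_of_ne c hj]
        exact hinv.tracked j
    · have h1 : ∑ j, credit (((explorer k ℓ).step T c i).mem j) + credit (c.mem i) =
          ∑ j, credit (c.mem j) + credit (acted T c i) := by
        have h2 : ∑ j ∈ Finset.univ.erase i, credit (((explorer k ℓ).step T c i).mem j) =
            ∑ j ∈ Finset.univ.erase i, credit (c.mem j) :=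
          Finset.sum_congr rfl fun j hj => by rw [step_mem_of_ne c (Finset.ne_of_mem_erase hj)]
        have h3 := Finset.add_sum_erase Finset.univ
          (fun j => credit (((explorer k ℓ).step T c i).mem j)) (Finset.mem_univ i)
        have h4 := Finset.add_sum_erase Finset.univ (fun j => credit (c.mem j)) (Finset.mem_univ i)
        have h5 : credit (((explorer k ℓ).step T c i).mem i) = credit (acted T c i) := by
          rw [step_mem_self]
        linarith
      have h2 := hinv.count
      push_cast
      linarith

/-- Moves on excursions traverse each edge at most once in either direction. The other moves of a
robot number at most the cost of the traversal algorithm on the layers that it has seen. -/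
theorem explorer_exploresWithin {c : ℝ} (hk : 1 ≤ k) (hℓ : IsCompetitive k c ℓ) (T : FinTree) :
    (explorer k ℓ).ExploresWithin T (2 * T.size + k * c * T.depth) := by
  intro s
  have hc := nonneg_of_isCompetitive hk hℓ
  have hM : (0 : ℝ) ≤ 2 * T.size + k * c * T.depth := by positivity
  refine ⟨⌊2 * (T.size : ℝ) + k * c * T.depth⌋₊, Nat.floor_le hM, ?_⟩
  by_contra hcon
  push Not at hcon
  set t := ⌊2 * (T.size : ℝ) + k * c * T.depth⌋₊ with ht
  have hinv := invariant_run hk hℓ.1 T s t hcon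
  set cf := (explorer k ℓ).run T s t with hcf
  have hop : (openedNodes T cf).card + 1 ≤ T.size := by
    have h1 : openedNodes T cf ⊆ T.nodes.erase [] := by
      classical
      intro v hv
      have hv' := (Finset.mem_filter.1 hv).2
      have := hinv.sound.opened_mem _ (known_board cf v.dropLast) v hv'
      exact Finset.mem_erase.2 ⟨this.2, this.1⟩
    have h2 := Finset.card_le_card h1
    rw [Finset.card_erase_of_mem T.root_mem] at h2
    have h3 := Finset.card_pos.2 ⟨_, T.root_mem⟩
    have h4 : T.size = T.nodes.card := rfl
    omega
  have hcr (i : Fin k) : ((credit (cf.mem i) : ℤ) : ℝ) ≤ c * T.depth := by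
    refine le_trans ?_ ((hinv.tracked i).length_le hk hℓ)
    have h1 := (hinv.sound.base_prefix i).length_le
    rw [← hinv.sound.pos_eq i] at h1
    have h2 : credit (cf.mem i) ≤ ((cf.mem i : Memory).layers.length : ℤ) := by
      unfold credit
      omega
    exact_mod_cast h2
  have hsum : ((∑ i, credit (cf.mem i) : ℤ) : ℝ) ≤ k * (c * T.depth) := by
    push_cast
    refine (Finset.sum_le_sum fun i _ => hcr i).trans ?_
    simp
  have h1 : (t : ℝ) = 2 * ((openedNodes T cf).card : ℝ) + ((∑ i, credit (cf.mem i) : ℤ) : ℝ) := by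
    exact_mod_cast congrArg (Int.cast (R := ℝ)) hinv.count
  have h2 : ((openedNodes T cf).card : ℝ) + 1 ≤ T.size := by exact_mod_cast hop
  have h3 := Nat.lt_floor_add_one (2 * (T.size : ℝ) + k * c * T.depth)
  rw [← ht] at h3
  linarith

/-! ### Independent groups of robots -/

section Groups

variable {m k : ℕ}

/-- Index of robot `i` in its group. -/
def member (hm : 0 < m) (i : Fin k) : Fin m := ⟨i % m, Nat.mod_lt _ hm⟩

/-- The robots are divided into groups of `m` robots (the last one may be smaller), and each group
explores the tree by the algorithm `A`, on its own part of the whiteboards. -/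
def grouped (A : DACTEAlgorithm m) (hm : 0 < m) (k : ℕ) : DACTEAlgorithm k where
  Mem := A.Mem
  Board := ℕ → A.Board
  emptyMem := A.emptyMem
  emptyBoard := fun _ => A.emptyBoard
  write i μ b N := Function.update b (i / m) (A.write (member hm i) μ (b (i / m)) N)
  remember i μ b N := A.remember (member hm i) μ (b (i / m)) N
  move i μ b N := A.move (member hm i) μ (b (i / m)) N
  move_mem i μ b N h := A.move_mem (member hm i) μ (b (i / m)) N h

/-- The subsequence of the activations of robots of group `g`. -/
noncomputable def groupSeq (hm : 0 < m) (s : ℕ → Fin k) (g : ℕ) (j : ℕ) : Fin m :=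
  member hm (s (Nat.nth (fun r => (s r : ℕ) / m = g) j))

/-- Number of activations of robots of group `g` in the first `t` rounds. -/
def groupCount (m : ℕ) (s : ℕ → Fin k) (g t : ℕ) : ℕ :=
  Nat.count (fun r => (s r : ℕ) / m = g) t

theorem eq_of_member_eq (hm : 0 < m) {i j : Fin k} (h : member hm i = member hm j)
    (h' : (i : ℕ) / m = j / m) : i = j := by
  have h1 : (i : ℕ) % m = j % m := congrArg Fin.val h
  apply Fin.ext
  rw [← Nat.div_add_mod (i : ℕ) m, ← Nat.div_add_mod (j : ℕ) m, h1, h']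

/-- Each group behaves as if it were alone. -/
theorem grouped_run (A : DACTEAlgorithm m) (hm : 0 < m) (T : FinTree) (s : ℕ → Fin k) (g t : ℕ) :
    (∀ i : Fin k, (i : ℕ) / m = g → ((grouped A hm k).run T s t).pos i =
      (A.run T (groupSeq hm s g) (groupCount m s g t)).pos (member hm i)) ∧
    (∀ i : Fin k, (i : ℕ) / m = g → ((grouped A hm k).run T s t).mem i =
      (A.run T (groupSeq hm s g) (groupCount m s g t)).mem (member hm i)) ∧
    ∀ u, (((grouped A hm k).run T s t).board u : ℕ → A.Board) g =
      (A.run T (groupSeq hm s g) (groupCount m s g t)).board u := by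
  induction t with
  | zero => exact ⟨fun i _ => rfl, fun i _ => rfl, fun u => rfl⟩
  | succ t ih =>
    obtain ⟨ih1, ih2, ih3⟩ := ih
    by_cases hg : (s t : ℕ) / m = g
    · have hcount : groupCount m s g (t + 1) = groupCount m s g t + 1 := by
        simp [groupCount, Nat.count_succ, hg]
      have hseq : groupSeq hm s g (groupCount m s g t) = member hm (s t) := by
        rw [groupSeq, groupCount, Nat.nth_count (p := fun r => (s r : ℕ) / m = g) hg]
      rw [hcount]
      simp only [DACTEAlgorithm.run, DACTEAlgorithm.step, hseq]
      have e1 := ih1 (s t) hg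
      have e2 := ih2 (s t) hg
      have e3 := ih3 (((grouped A hm k).run T s t).pos (s t))
      have hmove (μ b N) : (grouped A hm k).move (s t) μ b N =
          A.move (member hm (s t)) μ ((b : ℕ → A.Board) g) N := by
        rw [← hg]
        rfl
      have hrem (μ b N) : (grouped A hm k).remember (s t) μ b N =
          A.remember (member hm (s t)) μ ((b : ℕ → A.Board) g) N := by
        rw [← hg]
        rfl
      have hwrite (μ b N) : ((grouped A hm k).write (s t) μ b N : ℕ → A.Board) g =
          A.write (member hm (s t)) μ ((b : ℕ → A.Board) g) N := by
        rw [← hg]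
        exact Function.update_self _ _ _
      refine ⟨fun i hi => ?_, fun i hi => ?_, fun u => ?_⟩
      · by_cases h : i = s t
        · rw [h, Function.update_self, Function.update_self, ← e1, ← e2, ← e3, hmove]
        · rw [Function.update_of_ne h, Function.update_of_ne fun h' =>
            h (eq_of_member_eq hm h' (hi.trans hg.symm))]
          exact ih1 i hi
      · by_cases h : i = s t
        · rw [h, Function.update_self, Function.update_self, ← e1, ← e2, ← e3, hrem]
        · rw [Function.update_of_ne h, Function.update_of_ne fun h' =>
            h (eq_of_member_eq hm h' (hi.trans hg.symm))]
          exact ih2 i hi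
      · rw [← e1, ← e2, ← e3]
        by_cases h : u = ((grouped A hm k).run T s t).pos (s t)
        · rw [h, Function.update_self, Function.update_self, hwrite]
        · rw [Function.update_of_ne h, Function.update_of_ne h]
          exact ih3 u
    · have hcount : groupCount m s g (t + 1) = groupCount m s g t := by
        simp [groupCount, Nat.count_succ, hg]
      have hne {i : Fin k} (hi : (i : ℕ) / m = g) : i ≠ s t := fun h => hg (h ▸ hi)
      rw [hcount]
      simp only [DACTEAlgorithm.run, DACTEAlgorithm.step]
      refine ⟨fun i hi => ?_, fun i hi => ?_, fun u => ?_⟩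
      · rw [Function.update_of_ne (hne hi)]
        exact ih1 i hi
      · rw [Function.update_of_ne (hne hi)]
        exact ih2 i hi
      · by_cases h : u = ((grouped A hm k).run T s t).pos (s t)
        · rw [h, Function.update_self]
          refine Eq.trans ?_ (ih3 _)
          exact Function.update_of_ne (Ne.symm hg) _ _
        · rw [Function.update_of_ne h]
          exact ih3 u

theorem grouped_visited {A : DACTEAlgorithm m} {hm : 0 < m} {T : FinTree} {s : ℕ → Fin k}
    {g t : ℕ} {u : Node} (h : A.Visited T (groupSeq hm s g) (groupCount m s g t) u) :
    (grouped A hm k).Visited T s t u := by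
  obtain ⟨r', hr', hu⟩ := h
  set p : ℕ → Prop := fun r => (s r : ℕ) / m = g with hp
  have hlt : Nat.nth p r' < t := Nat.nth_lt_of_lt_count hr'
  have hfin (hf : (Set.ofPred p).Finite) : r' < hf.toFinset.card :=
    lt_of_lt_of_le hr' (Nat.count_le_card hf t)
  have hmem : p (Nat.nth p r') := Nat.nth_mem r' hfin
  have hcount : groupCount m s g (Nat.nth p r') = r' := Nat.count_nth hfin
  refine ⟨Nat.nth p r', hlt, ?_⟩
  rw [(grouped_run A hm T s g (Nat.nth p r')).1 _ hmem, hcount]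
  exact hu

theorem sum_groupCount {G : ℕ} (hG : ∀ i : Fin k, (i : ℕ) / m < G) (s : ℕ → Fin k) (t : ℕ) :
    ∑ g ∈ Finset.range G, groupCount m s g t = t := by
  induction t with
  | zero => simp [groupCount]
  | succ t ih =>
    have h1 (g : ℕ) : groupCount m s g (t + 1) =
        groupCount m s g t + if (s t : ℕ) / m = g then 1 else 0 := by
      simp only [groupCount, Nat.count_succ]
    simp only [h1, Finset.sum_add_distrib, ih, Finset.sum_ite_eq, Finset.mem_range, hG, if_true]

/-- By the pigeonhole principle, some group is active long enough to explore the tree. -/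
theorem grouped_exploresWithin {A : DACTEAlgorithm m} (hm : 0 < m) {T : FinTree} {M : ℝ}
    (h : A.ExploresWithin T M) (hM : 0 ≤ M) {G : ℕ} (hG0 : 0 < G)
    (hG : ∀ i : Fin k, (i : ℕ) / m < G) : (grouped A hm k).ExploresWithin T (G * M) := by
  intro s
  refine ⟨G * ⌊M⌋₊, ?_, fun u hu => ?_⟩
  · push_cast
    exact mul_le_mul_of_nonneg_left (Nat.floor_le hM) (Nat.cast_nonneg G)
  · obtain ⟨g, hg⟩ : ∃ g, ⌊M⌋₊ ≤ groupCount m s g (G * ⌊M⌋₊) := by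
      by_contra hcon
      push Not at hcon
      have h1 := Finset.sum_lt_sum_of_nonempty (s := Finset.range G)
        (Finset.nonempty_range_iff.2 hG0.ne') fun g _ => hcon g
      rw [sum_groupCount hG] at h1
      simp at h1
    obtain ⟨t, ht, hv⟩ := h (groupSeq hm s g)
    obtain ⟨r, hr, hru⟩ := hv u hu
    have ht' : t ≤ ⌊M⌋₊ := Nat.le_floor ht
    exact grouped_visited ⟨r, by omega, hru⟩

end Groups

theorem sq_le_two_mul_two_pow (m : ℕ) : m ^ 2 ≤ 2 * 2 ^ m := by
  rcases Nat.lt_or_ge m 3 with h | h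
  · interval_cases m <;> norm_num
  · induction m, h using Nat.le_induction with
    | base => norm_num
    | succ m hm ih =>
      rw [pow_succ 2 m]
      nlinarith

theorem exists_explorer {k : ℕ} (hk : 1 ≤ k) : ∃ A : DACTEAlgorithm k, ∀ T : FinTree,
    A.ExploresWithin T (2 * T.size + 162 * ((k : ℝ) ^ 2 * 2 ^ k * T.depth)) := by
  refine ⟨explorer k (Traversal.algorithm k), fun T => ?_⟩
  have h := explorer_exploresWithin hk (Traversal.algorithm_isCompetitive hk) T
  have e : (2 * T.size + k * (162 * (k * 2 ^ k)) * T.depth : ℝ) =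
      2 * T.size + 162 * ((k : ℝ) ^ 2 * 2 ^ k * T.depth) := by ring
  rwa [e] at h

/-- Groups of about `log k / 2` robots: the overhead `m ^ 2 * 2 ^ m` of a group of `m` robots is
then at most of the order of `k`, and there are `O(k / log k)` groups. -/
theorem exists_grouped {k : ℕ} (hk : 2 ≤ k) : ∃ A : DACTEAlgorithm k, ∀ T : FinTree,
    A.ExploresWithin T (5184 * (k / Real.logb 2 k) * (T.size + k * T.depth)) := by
  set m := Nat.log 4 k + 1 with hm
  have hm0 : 0 < m := Nat.succ_pos _
  obtain ⟨A, hA⟩ := exists_explorer (k := m) hm0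
  refine ⟨grouped A hm0 k, fun T => ?_⟩
  set M : ℝ := 2 * T.size + 162 * ((m : ℝ) ^ 2 * 2 ^ m * T.depth) with hM
  have hM0 : 0 ≤ M := by positivity
  have hG := grouped_exploresWithin (k := k) hm0 (hA T) hM0 (G := (k - 1) / m + 1)
    (Nat.succ_pos _) fun i => Nat.lt_succ_of_le (Nat.div_le_div_right (by omega))
  have hk0 : (2 : ℝ) ≤ k := by exact_mod_cast hk
  have hmr : (0 : ℝ) < m := by exact_mod_cast hm0
  have hlog : 0 < Real.logb 2 k := Real.logb_pos (by norm_num) (by linarith)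
  have hlogm : Real.logb 2 k ≤ 2 * m := by
    have h1 : k < 4 ^ m := Nat.lt_pow_succ_log_self (by norm_num) k
    have h2 : (k : ℝ) ≤ 2 ^ (2 * m) := by
      have : k ≤ 2 ^ (2 * m) := by rw [pow_mul]; exact h1.le
      exact_mod_cast this
    rw [Real.logb_le_iff_le_rpow (by norm_num) (by linarith)]
    have h3 : ((2 * m : ℕ) : ℝ) = 2 * m := by push_cast; ring
    rw [← h3, Real.rpow_natCast]
    exact h2
  have hmk : m ≤ k := Nat.log_lt_self 4 (by omega)
  have hgroups : (((k - 1) / m + 1 : ℕ) : ℝ) ≤ 4 * (k / Real.logb 2 k) := by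
    have h1 : (((k - 1) / m : ℕ) : ℝ) ≤ k / m := by
      refine (Nat.cast_div_le).trans ?_
      gcongr
      omega
    have h2 : (1 : ℝ) ≤ k / m := by
      rw [le_div_iff₀ hmr, one_mul]
      exact_mod_cast hmk
    have h3 : (k : ℝ) / m ≤ 2 * (k / Real.logb 2 k) := by
      rw [← mul_div_assoc, div_le_div_iff₀ hmr hlog]
      nlinarith
    push_cast
    linarith
  have hover : (m : ℝ) ^ 2 * 2 ^ m ≤ 8 * k := by
    have h1 : 4 ^ Nat.log 4 k ≤ k := Nat.pow_log_le_self 4 (by omega)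
    have h2 : m ^ 2 * 2 ^ m ≤ 8 * k := by
      calc m ^ 2 * 2 ^ m ≤ 2 * 2 ^ m * 2 ^ m := Nat.mul_le_mul_right _ (sq_le_two_mul_two_pow m)
        _ = 2 * 4 ^ m := by rw [mul_assoc, ← mul_pow]; norm_num
        _ = 8 * 4 ^ Nat.log 4 k := by rw [hm, pow_succ]; ring
        _ ≤ 8 * k := by omega
    exact_mod_cast h2
  have hM' : M ≤ 1296 * (T.size + k * T.depth) := by
    have h1 := mul_le_mul_of_nonneg_right hover (Nat.cast_nonneg (α := ℝ) T.depth)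
    have h2 : (0 : ℝ) ≤ T.size := Nat.cast_nonneg _
    rw [hM]
    linarith
  intro s
  obtain ⟨t, ht, hv⟩ := hG s
  refine ⟨t, ht.trans ?_, hv⟩
  calc (((k - 1) / m + 1 : ℕ) : ℝ) * M
      ≤ 4 * (k / Real.logb 2 k) * (1296 * (T.size + k * T.depth)) :=
        mul_le_mul hgroups hM' hM0 (by positivity)
    _ = 5184 * (k / Real.logb 2 k) * (T.size + k * T.depth) := by ring

end Exploration

theorem mainTheorem1 :
    (∃ C : ℝ, ∀ k : ℕ, 1 ≤ k → ∃ A : DACTEAlgorithm k, ∀ T : FinTree,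
      A.ExploresWithin T (2 * T.size + C * ((k : ℝ) ^ 2 * 2 ^ k * T.depth))) ∧
    (∀ (k : ℕ) (c : ℝ) (ℓ : List (Finset Node) → Node), 1 ≤ k → IsCompetitive k c ℓ →
      ∃ A : DACTEAlgorithm k, ∀ T : FinTree,
        A.ExploresWithin T (2 * T.size + k * c * T.depth)) ∧
    (∃ C : ℝ, ∀ k : ℕ, 2 ≤ k → ∃ A : DACTEAlgorithm k, ∀ T : FinTree,
      A.ExploresWithin T (C * (k / Real.logb 2 k) * (T.size + k * T.depth))) :=
  ⟨⟨162, fun _ hk => Exploration.exists_explorer hk⟩,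
    fun k _ ℓ hk hℓ =>
      ⟨Exploration.explorer k ℓ, fun T => Exploration.explorer_exploresWithin hk hℓ T⟩,
    ⟨5184, fun _ hk => Exploration.exists_grouped hk⟩⟩
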